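/- **Model.** Let $E\subset\mathbb R^d$ be open, let $\mathbb U,\widetilde{\mathbb U}$ be Borel spaces, and let $\phi:\mathbb R^d\times[0,\infty)\to\mathbb R^d$ be continuous with $\phi(x,0)=x$ and $\phi(x,t+s)=\phi(\phi(x,t),s)$. For $x\in E$ put $t_*(x)=\inf\{t>0:\phi(x,t)\in\partial E\}$ ($\inf\emptyset=\infty$), and $\phi(x,t_*(x)):=\Delta$ if $t_*(x)=\infty$, where $\Delta\in\partial E$ is fixed. Let $\mathbb U(x)\subset\mathbb U$ ($x\in\overline E$), a measurable $\ell:E\times\mathbb U\times[0,\infty)\to\widetilde{\mathbb U}$, a measurable rate $\lambda\ge 0$ on $\overline E\times\widetilde{\mathbb U}$ and a stochastic kernel $Q$ on $E$ given $(E\times\widetilde{\mathbb U})\cup(\partial E\times\mathbb U)$ with $Q(x,\widetilde a;\{x\})=0$ for $x\in E$ be given. Put $\mathbb S(x)=\mathbb U(x)\times\mathbb U(\phi(x,t_*(x)))$ and $\mathcal K=\{(x,\widehat a):x\in E,\ \widehat a=(a,a_\partial)\in\mathbb S(x)\}$. A selector is a stochastic kernel $\eta$ on $\mathbb U\times\mathbb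 U$ given $E$ with $\eta(x;\mathbb S(x))=1$ for all $x$; a strategy is a sequence $U=(\eta_k)_{k\ge0}$ of selectors, and $U^\varphi$ is the stationary strategy with $\eta_k=\varphi$ for all $k$. Let $\Lambda^a(x,t)=\int_0^t\lambda(\phi(x,s),\ell(x,a,s))\,ds$, and let $\nu_0$ be a probability measure on $E$. Under $P^U_{\nu_0}$ the process starts at $T_0=0$ with $Z_0\sim\nu_0$, $\Theta_0\sim\eta_0(Z_0;\cdot)$. Given the past up to $T_k<\infty$, with $Z_k=x$ and $\Theta_k=(\theta_k,\theta_{k,\partial})=(a,a_\partial)$: the time $S=T_{k+1}-T_k$ satisfies $P(S>t)=e^{-\Lambda^a(x,t)}$ for $t<t_*(x)$ and $P(S>t)=0$ for $t\ge t_*(x)$; given $S<\infty$, $Z_{k+1}$ has law $Q(\phi(x,S),\ell(x,a,S);\cdot)$ if $S<t_*(x)$ and $Q(\phi(x,t_*(x)),a_\partial;\cdot)$ if $S=t_*(x)$; and $\Theta_{k+1}\sim\eta_{k+1}(Z_{k+1};\cdot)$. Let $T_\infty=\lim_k T_k$, let $N(t)$ be the number of jumps up to time $t$, $X(t)=\phi(Z_{N(t)},t-T_{N(t)})$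 for $t<T_\infty$, and let $p^*(t)$ be the number of jumps $T_i\le t$ with $X(T_i-)\in\partial E$. For measurable $f_i:E\times\mathbb U\to[0,\infty)$, $r_i:\partial E\times\mathbb U\to[0,\infty)$ ($0\le i\le m$), reals $d_1,\dots,d_m$ and $\alpha>0$ put $$\mathcal D_i^\alpha(U,\nu_0)=E^U_{\nu_0}\Big[\int_0^{T_\infty}e^{-\alpha s}f_i(X(s),\theta_{N(s)})\,ds+\int_{]0,T_\infty]}e^{-\alpha s}r_i(X(s-),\theta_{N(s-),\partial})\,dp^*(s)\Big],$$ $$\mathcal J_{\mathcal D}^\alpha(\nu_0)=\inf\{\mathcal D_0^\alpha(U,\nu_0):U\text{ a strategy},\ \mathcal D_i^\alpha(U,\nu_0)\le d_i,\ 1\le i\le m\}.$$ Let $\mathcal U_f$ be the set of strategies with $\mathcal D_0^\alpha(U,\nu_0)<\infty$ and $\mathcal D_i^\alpha(U,\nu_0)\le d_i$, $1\le i\le m$. **Operators.** For $(x,\widehat a)\in\mathcal K$ and nonnegative measurable $h$, $g$ put (with $e^{-\infty}=0$, and with $h$ on $E$ regarded as a function on $E\times\mathbb U$) $$Lh(x,\widehat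 a)=\int_0^{t_*(x)}e^{-\alpha s-\Lambda^a(x,s)}h(\phi(x,s),a)\,ds,\qquad Hg(x,\widehat a)=e^{-\alpha t_*(x)-\Lambda^a(x,t_*(x))}g(\phi(x,t_*(x)),a_\partial),$$ $$G(x,\widehat a;B)=\int_0^{t_*(x)}e^{-\alpha s-\Lambda^a(x,s)}\lambda(\phi(x,s),\ell(x,a,s))\,Q(\phi(x,s),\ell(x,a,s);B)\,ds+e^{-\alpha t_*(x)-\Lambda^a(x,t_*(x))}Q(\phi(x,t_*(x)),a_\partial;B),$$ and for signed $h$, $Lh=Lh^+-Lh^-$. Fix $c_0>0$ and put $w=c_0+Lf_0+Hr_0$ on $\mathcal K$ and $w_0(x)=\inf_{\widehat a\in\mathbb S(x)}w(x,\widehat a)$. Write $h(x,\varphi)=\int_{\mathbb S(x)}h(x,\widehat a)\,\varphi(x;d\widehat a)$. **Assumptions.** 1. $\mathcal K$ is a Borel subset of $E\times\mathbb U\times\mathbb U$. 2. $\mathcal J_{\mathcal D}^\alpha(\nu_0)<\infty$. 3. There are measurable functions $\overline\lambda$ and $\underline\lambda$ and a constant $K_\lambda<\infty$ with $0<\underline\lambda(x)\le\lambda(x,\widetilde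 a)\le\overline\lambda(x)<\infty$ on $E\times\widetilde{\mathbb U}$ and, for every $x\in E$, $\int_0^t\overline\lambda(\phi(x,s))ds<\infty$ for $t<t_*(x)$, and also for $t=t_*(x)$ if $t_*(x)<\infty$, and $\int_0^{t_*(x)}e^{-\int_0^t\underline\lambda(\phi(x,s))ds}dt\le K_\lambda$. 4. (Expected growth.) $w$ and $w_0$ are finite and measurable, and there are a measurable $b:E\to\mathbb R$, a real $c>-\alpha$ and a measurable $v:E\to[0,\infty)$ with $\sup_E v/w_0<\infty$ such that, for each $x\in E$, $t\mapsto v(\phi(x,t))$ is absolutely continuous on the compact subintervals of $[0,t_*(x))$ and has a finite limit, written $v(\phi(x,t_*(x)))$, as $t\to t_*(x)$ when $t_*(x)<\infty$; and such that, for some measurable $\mathcal Xv:E\to\mathbb R$ with $v(\phi(x,t))-v(x)=\int_0^t\mathcal Xv(\phi(x,s))ds$ for all $x\in E$, $t<t_*(x)$, one has for all $(x,\widehat a)\in\mathcal K$: $Lb(x,\widehat a)$ is well defined and finite; for all $t\in[0,t_*(x))$, with $y=\phi(x,t)$ and $\widetilde a=\ell(x,a,t)$, $$\mathcal Xv(y)+c\,v(y)-\lambda(y,\widetilde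 a)\Big[v(y)-\int v\,dQ(y,\widetilde a;\cdot)\Big]\le b(y),\qquad \lambda(y,\widetilde a)+\frac{b(y)}{c+\alpha}\le v(y);$$ and, if $t_*(x)<\infty$, $v(\phi(x,t_*(x)))\ge\int v\,dQ(\phi(x,t_*(x)),a_\partial;\cdot)+c+\alpha$ (all these integrals of $v$ being finite). **Linear program.** Let $\mathcal M_w(\mathcal K)_+$ be the set of finite positive measures $\mu$ on $\mathcal K$ with $\int w\,d\mu<\infty$, let $\widetilde\mu$ denote the marginal of $\mu$ on $E$, and let $\mathbf L$ (the feasible set of Problem $\mathbf P$) be the set of $\mu\in\mathcal M_w(\mathcal K)_+$ with $$\widetilde\mu(B)-\int_{\mathcal K}G(x,\widehat a;B)\,d\mu=\nu_0(B)\quad(B\in\mathcal B(E)),\qquad\int_{\mathcal K}(Lf_i+Hr_i)\,d\mu\le d_i\quad(1\le i\le m).$$ Problem $\mathbf P$ is to compute $\inf_{\mu\in\mathbf L}\int_{\mathcal K}(Lf_0+Hr_0)\,d\mu$. For a strategy $U$ let $\mu^U_{\nu_0}(\Gamma)=\sum_{k\ge0}E^U_{\nu_0}[e^{-\alpha T_k}I_\Gamma(Z_k,\Theta_k)]$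 for Borel $\Gamma\subset\mathcal K$. **Theorem.** Under these assumptions: (a) For every $U\in\mathcal U_f$, $\mu^U_{\nu_0}\in\mathcal M_w(\mathcal K)_+$ is feasible for $\mathbf P$, and $$\mathcal D_0^\alpha(U,\nu_0)=\int_{\mathcal K}(Lf_0+Hr_0)\,d\mu^U_{\nu_0}\ \ge\ \inf_{\mu\in\mathbf L}\int_{\mathcal K}(Lf_0+Hr_0)\,d\mu.$$ (b) For every $\mu\in\mathbf L$ there is a selector $\varphi$ such that $$\mathcal J_{\mathcal D}^\alpha(\nu_0)\le\mathcal D_0^\alpha(U^\varphi,\nu_0)=\int_{\mathcal K}(Lf_0+Hr_0)\,d\mu=\int_E\big(Lf_0(x,\varphi)+Hr_0(x,\varphi)\big)\,\widetilde\mu(dx),\qquad\mathcal D_i^\alpha(U^\varphi,\nu_0)\le d_i\quad(1\le i\le m).$$ Moreover $\displaystyle\mathcal J_{\mathcal D}^\alpha(\nu_0)=\inf_{\mu\in\mathbf L}\int_{\mathcal K}(Lf_0+Hr_0)\,d\mu.$ -/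

import Mathlib

open MeasureTheory ProbabilityTheory Set Filter Topology
open scoped NNReal ENNReal

namespace PDMP

/-- Lebesgue measure on the half-line `[0, ∞)`. -/
noncomputable def leb : Measure ℝ≥0 :=
  ((volume : Measure ℝ).restrict (Ici 0)).map Real.toNNReal

instance : SFinite leb := by unfold leb; infer_instance

/-- `e^{-y}` for `y ∈ [0, ∞]`, with `e^{-∞} = 0`. -/
noncomputable def expNeg (y : ℝ≥0∞) : ℝ≥0∞ :=
  if y = ⊤ then 0 else ENNReal.ofReal (Real.exp (-y.toReal))

end PDMP

/-- The local characteristics of a controlled piecewise deterministic process on an open set `E`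
of `ℝ^d`, with control space `U` and space `V` of values of the interjump control `ell`.
Between two jumps the process is in `E` and the transition measure is `Q`; at the boundary it
is `Qb`.  (The two kernels together are one kernel on `E` given `(E × V) ∪ (∂E × U)`, a disjoint
union as `E` is open.)  The rate `lam` is only ever evaluated inside `E`. -/
structure PDMP (d : ℕ) (U V : Type*) [MeasurableSpace U] [MeasurableSpace V] where
  E : Set (EuclideanSpace ℝ (Fin d))
  isOpen_E : IsOpen E
  flow : EuclideanSpace ℝ (Fin d) → ℝ≥0 → EuclideanSpace ℝ (Fin d)
  continuous_flow : Continuous fun p : EuclideanSpace ℝ (Fin d) × ℝ≥0 => flow p.1 p.2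
  flow_zero : ∀ x, flow x 0 = x
  flow_add : ∀ x t s, flow x (t + s) = flow (flow x t) s
  /-- the conventional exit point of the trajectories that never reach the boundary -/
  Δ : frontier E
  /-- the feasible actions at a point of the closure of `E` -/
  feas : closure E → Set U
  ell : E × U × ℝ≥0 → V
  measurable_ell : Measurable ell
  lam : E × V → ℝ≥0
  measurable_lam : Measurable lam
  Q : Kernel (E × V) E
  isMarkov_Q : IsMarkovKernel Q
  Q_self : ∀ x v, Q (x, v) {x} = 0
  Qb : Kernel (frontier E × U) E
  isMarkov_Qb : IsMarkovKernel Qb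

/-- Running costs `f 0, …, f m` and boundary costs `r 0, …, r m`: index `0` is the objective, the
others are the constraints, with limits `lim`. -/
structure PDMPCosts {d : ℕ} {U V : Type*} [MeasurableSpace U] [MeasurableSpace V]
    (D : PDMP d U V) (m : ℕ) where
  f : Fin (m + 1) → D.E × U → ℝ≥0
  measurable_f : ∀ i, Measurable (f i)
  r : Fin (m + 1) → frontier D.E × U → ℝ≥0
  measurable_r : ∀ i, Measurable (r i)
  lim : Fin m → ℝ

namespace PDMP

variable {d : ℕ} {U V : Type*} [MeasurableSpace U] [MeasurableSpace V] (D : PDMP d U V)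

attribute [instance] PDMP.isMarkov_Q PDMP.isMarkov_Qb

/-! ### Hitting time of the boundary, flow inside `E`, exit point -/

/-- `t_*(x) = inf {t > 0 : φ(x,t) ∈ ∂E}`, with `inf ∅ = ∞`. -/
noncomputable def tstar (x : D.E) : ℝ≥0∞ :=
  ⨅ (t : ℝ≥0) (_ : 0 < t ∧ D.flow x t ∈ frontier D.E), (t : ℝ≥0∞)

open Classical in
/-- The flow as a point of `E`; for `t < t_*(x)` this is `φ(x,t)`. It is only used there. -/
noncomputable def flowE (x : D.E) (t : ℝ≥0) : D.E :=
  if h : D.flow x t ∈ D.E then ⟨D.flow x t, h⟩ else x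

open Classical in
/-- The exit point `φ(x,t_*(x))`, equal to `Δ` if `t_*(x) = ∞`. (If `t_*(x) < ∞`, the point
`φ(x,t_*(x))` is in `∂E`, as `∂E` is closed.) -/
noncomputable def exit (x : D.E) : frontier D.E :=
  if h : D.tstar x ≠ ⊤ ∧ D.flow x (D.tstar x).toNNReal ∈ frontier D.E then
    ⟨D.flow x (D.tstar x).toNNReal, h.2⟩ else D.Δ

/-- The set `𝕊(x)` of feasible pairs of actions `(a, a_∂)`. -/
def S (x : D.E) : Set (U × U) :=
  {a | a.1 ∈ D.feas ⟨x, subset_closure x.2⟩ ∧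
    a.2 ∈ D.feas ⟨D.exit x, frontier_subset_closure (D.exit x).2⟩}

/-- The set `𝒦` of feasible state-action triples `(x, (a, a_∂))`. -/
def K : Set (D.E × (U × U)) := {p | p.2 ∈ D.S p.1}

/-- The cumulated jump rate `Λ^a(x,t) = ∫_0^t λ(φ(x,s), ℓ(x,a,s)) ds`, for `t ≤ t_*(x)`. -/
noncomputable def Lam (x : D.E) (a : U) (t : ℝ≥0∞) : ℝ≥0∞ :=
  ∫⁻ s in {s : ℝ≥0 | (s : ℝ≥0∞) < t}, (D.lam (D.flowE x s, D.ell (x, a, s)) : ℝ≥0∞) ∂leb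

/-! ### Measurability of the ingredients -/

lemma tstar_le_iff (x : D.E) (q : ℝ≥0) :
    D.tstar x ≤ q ↔ ∃ t ∈ Icc (0 : ℝ≥0) q, D.flow x t ∈ frontier D.E := by
  have hc : Continuous fun t : ℝ≥0 => D.flow x t :=
    D.continuous_flow.comp (by fun_prop : Continuous fun t : ℝ≥0 => ((x : EuclideanSpace ℝ (Fin d)), t))
  have hcl : IsClosed {t : ℝ≥0 | D.flow x t ∈ frontier D.E} := isClosed_frontier.preimage hc
  have h0 : D.flow x 0 ∉ frontier D.E := by
    rw [D.flow_zero, D.isOpen_E.frontier_eq]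
    exact fun h => h.2 x.2
  constructor
  · intro hle
    have hlt : D.tstar x < ((q + 1 : ℝ≥0) : ℝ≥0∞) :=
      lt_of_le_of_lt hle (by exact_mod_cast lt_add_one q)
    simp only [tstar, iInf_lt_iff] at hlt
    obtain ⟨t, ⟨-, htF⟩, htq⟩ := hlt
    have htq' : t < q + 1 := by exact_mod_cast htq
    have hcomp : IsCompact ({t : ℝ≥0 | D.flow x t ∈ frontier D.E} ∩ Icc 0 (q + 1)) :=
      isCompact_Icc.inter_left hcl
    obtain ⟨t0, ⟨ht0, -⟩, hmin⟩ := hcomp.exists_isLeast ⟨t, htF, by simp, htq'.le⟩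
    refine ⟨t0, ⟨by simp, ?_⟩, ht0⟩
    have : (t0 : ℝ≥0∞) ≤ D.tstar x := by
      refine le_iInf₂ fun u hu => ?_
      rcases le_total u (q + 1) with h | h
      · exact_mod_cast hmin ⟨hu.2, by simp, h⟩
      · exact_mod_cast (hmin ⟨htF, by simp, htq'.le⟩ : t0 ≤ t).trans (htq'.le.trans h)
    exact_mod_cast this.trans hle
  · rintro ⟨t, ht, htF⟩
    have hpos : 0 < t := by
      rcases eq_or_ne t 0 with h | h
      · exact absurd (h ▸ htF) h0
      · exact pos_iff_ne_zero.mpr h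
    exact (iInf₂_le t ⟨hpos, htF⟩).trans (by exact_mod_cast ht.2)

lemma measurable_tstar : Measurable D.tstar := by
  refine measurable_of_Iic fun q => ?_
  induction q using ENNReal.recTopCoe with
  | top => simp
  | coe q =>
    have hK : IsCompact (Icc (0 : ℝ≥0) q) := isCompact_Icc
    have : CompactSpace (Icc (0 : ℝ≥0) q) := isCompact_iff_compactSpace.mp hK
    have hcl : IsClosed {p : D.E × Icc (0 : ℝ≥0) q | D.flow p.1 p.2 ∈ frontier D.E} := by
      exact isClosed_frontier.preimage (D.continuous_flow.comp
        (by fun_prop : Continuous fun p : D.E × Icc (0 : ℝ≥0) q =>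
          ((p.1 : EuclideanSpace ℝ (Fin d)), (p.2 : ℝ≥0))))
    have himg := isClosedMap_fst_of_compactSpace _ hcl
    have : D.tstar ⁻¹' Iic (q : ℝ≥0∞) =
        Prod.fst '' {p : D.E × Icc (0 : ℝ≥0) q | D.flow p.1 p.2 ∈ frontier D.E} := by
      ext x
      simp only [mem_preimage, mem_Iic, tstar_le_iff, mem_image, Prod.exists, exists_and_right,
        exists_eq_right]
      constructor
      · rintro ⟨t, ht, h⟩
        exact ⟨⟨t, ht⟩, h⟩
      · rintro ⟨t, h⟩
        exact ⟨t, t.2, h⟩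
    rw [this]
    exact himg.measurableSet

lemma measurable_flowE : Measurable fun p : D.E × ℝ≥0 => D.flowE p.1 p.2 := by
  classical
  have hc : Measurable fun p : D.E × ℝ≥0 => D.flow p.1 p.2 :=
    (D.continuous_flow.comp
      (by fun_prop : Continuous fun p : D.E × ℝ≥0 =>
        ((p.1 : EuclideanSpace ℝ (Fin d)), p.2))).measurable
  have hE : MeasurableSet D.E := D.isOpen_E.measurableSet
  rw [← (MeasurableEmbedding.subtype_coe hE).measurable_comp_iff]
  have : (Subtype.val ∘ fun p : D.E × ℝ≥0 => D.flowE p.1 p.2) =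
      fun p : D.E × ℝ≥0 => if D.flow p.1 p.2 ∈ D.E then D.flow p.1 p.2 else p.1 := by
    ext1 p
    simp only [Function.comp, flowE]
    split_ifs <;> rfl
  rw [this]
  exact Measurable.ite (hc hE) hc (by fun_prop)

lemma measurable_exit : Measurable D.exit := by
  classical
  have hc : Measurable fun p : D.E × ℝ≥0 => D.flow p.1 p.2 :=
    (D.continuous_flow.comp
      (by fun_prop : Continuous fun p : D.E × ℝ≥0 =>
        ((p.1 : EuclideanSpace ℝ (Fin d)), p.2))).measurable
  have hx : Measurable fun x : D.E => D.flow x (D.tstar x).toNNReal :=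
    hc.comp (measurable_id.prodMk D.measurable_tstar.ennreal_toNNReal)
  have hF : MeasurableSet (frontier D.E) := isClosed_frontier.measurableSet
  rw [← (MeasurableEmbedding.subtype_coe hF).measurable_comp_iff]
  have : (Subtype.val ∘ D.exit) =
      fun x => if D.tstar x ≠ ⊤ ∧ D.flow x (D.tstar x).toNNReal ∈ frontier D.E then
        D.flow x (D.tstar x).toNNReal else D.Δ := by
    ext1 p
    simp only [Function.comp, exit]
    split_ifs <;> rfl
  rw [this]
  refine Measurable.ite ?_ hx measurable_const
  exact ((D.measurable_tstar (measurableSet_singleton ⊤)).compl).inter (hx hF)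

lemma measurable_Lam (t : ℝ≥0∞) : Measurable fun p : D.E × U => D.Lam p.1 p.2 t := by
  unfold Lam
  refine Measurable.lintegral_prod_right' (ν := leb.restrict {s : ℝ≥0 | (s : ℝ≥0∞) < t})
    (f := fun q : (D.E × U) × ℝ≥0 =>
      (D.lam (D.flowE q.1.1 q.2, D.ell (q.1.1, q.1.2, q.2)) : ℝ≥0∞)) ?_
  have h1 : Measurable fun q : (D.E × U) × ℝ≥0 => D.flowE q.1.1 q.2 :=
    D.measurable_flowE.comp (by fun_prop : Measurable fun q : (D.E × U) × ℝ≥0 => (q.1.1, q.2))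
  have h2 : Measurable fun q : (D.E × U) × ℝ≥0 => D.ell (q.1.1, q.1.2, q.2) :=
    D.measurable_ell.comp (by fun_prop)
  exact (D.measurable_lam.comp (h1.prodMk h2)).coe_nnreal_ennreal

/-! ### The law of the interjump time and of the post-jump location -/

/-- The time at which the cumulated rate reaches the level `ξ`, or `t_*(x)` if that comes first. -/
noncomputable def jumpTime (x : D.E) (a : U) (ξ : ℝ) : ℝ≥0∞ :=
  ⨆ (t : ℝ≥0) (_ : (t : ℝ≥0∞) < D.tstar x ∧ D.Lam x a t < ENNReal.ofReal ξ), (t : ℝ≥0∞)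

lemma Lam_mono (x : D.E) (a : U) : Monotone (D.Lam x a) := fun _ _ hst =>
  lintegral_mono_set fun _ hu => lt_of_lt_of_le hu hst

lemma measurable_jumpTime :
    Measurable fun p : (D.E × U) × ℝ => D.jumpTime p.1.1 p.1.2 p.2 := by
  refine measurable_of_Ioi fun q => ?_
  have : (fun p : (D.E × U) × ℝ => D.jumpTime p.1.1 p.1.2 p.2) ⁻¹' Ioi q =
      ⋃ t : ℚ, {p | q < ENNReal.ofReal t ∧ ENNReal.ofReal t < D.tstar p.1.1 ∧
        D.Lam p.1.1 p.1.2 (ENNReal.ofReal t) < ENNReal.ofReal p.2} := by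
    ext p
    simp only [mem_preimage, mem_Ioi, jumpTime, lt_iSup_iff, mem_iUnion, mem_ofPred_eq]
    constructor
    · rintro ⟨t, ⟨h1, h2⟩, h3⟩
      obtain ⟨s, -, hs, hst⟩ := ENNReal.lt_iff_exists_rat_btwn.mp h3
      change q < ENNReal.ofReal s at hs
      change ENNReal.ofReal s < t at hst
      exact ⟨s, hs, hst.trans h1, (D.Lam_mono _ _ hst.le).trans_lt h2⟩
    · rintro ⟨t, h1, h2, h3⟩
      exact ⟨(t : ℝ).toNNReal, ⟨h2, h3⟩, h1⟩
  rw [this]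
  refine MeasurableSet.iUnion fun t => ?_
  refine (MeasurableSet.const _).inter (MeasurableSet.inter ?_ ?_)
  · exact measurableSet_lt measurable_const (D.measurable_tstar.comp (by fun_prop))
  · exact measurableSet_lt ((D.measurable_Lam _).comp measurable_fst)
      (ENNReal.measurable_ofReal.comp measurable_snd)

/-- The law of the interjump time `T` from the post-jump location `x` under the action `a`:
`P(T > t) = e^{-Λ^a(x,t)}` for `t < t_*(x)` and `P(T > t) = 0` for `t ≥ t_*(x)`. It is realised as
the law of `jumpTime x a ξ`, where `ξ` has the exponential distribution of parameter `1`. -/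
noncomputable def sojourn : Kernel (D.E × U) ℝ≥0∞ :=
  Kernel.map (Kernel.prod Kernel.id (Kernel.const (D.E × U) (expMeasure 1)))
    (fun p => D.jumpTime p.1.1 p.1.2 p.2)

instance : IsMarkovKernel D.sojourn := by
  have : IsProbabilityMeasure (expMeasure 1) := isProbabilityMeasure_expMeasure one_pos
  exact Kernel.IsMarkovKernel.map _ D.measurable_jumpTime

lemma measurableSet_lt_tstar :
    MeasurableSet {p : (D.E × (U × U)) × ℝ≥0∞ | p.2 < D.tstar p.1.1} :=
  measurableSet_lt measurable_snd (D.measurable_tstar.comp (by fun_prop))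

lemma measurable_preJump : Measurable fun p : (D.E × (U × U)) × ℝ≥0∞ =>
    (D.flowE p.1.1 p.2.toNNReal, D.ell (p.1.1, p.1.2.1, p.2.toNNReal)) := by
  have h1 : Measurable fun p : (D.E × (U × U)) × ℝ≥0∞ => D.flowE p.1.1 p.2.toNNReal :=
    D.measurable_flowE.comp
      ((by fun_prop : Measurable fun p : (D.E × (U × U)) × ℝ≥0∞ => p.1.1).prodMk
        measurable_snd.ennreal_toNNReal)
  have h2 : Measurable fun p : (D.E × (U × U)) × ℝ≥0∞ =>
      D.ell (p.1.1, p.1.2.1, p.2.toNNReal) := D.measurable_ell.comp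
    ((by fun_prop : Measurable fun p : (D.E × (U × U)) × ℝ≥0∞ => p.1.1).prodMk
      ((by fun_prop : Measurable fun p : (D.E × (U × U)) × ℝ≥0∞ => p.1.2.1).prodMk
        measurable_snd.ennreal_toNNReal))
  exact h1.prodMk h2

lemma measurable_preJumpBoundary : Measurable fun p : (D.E × (U × U)) × ℝ≥0∞ =>
    (D.exit p.1.1, p.1.2.2) :=
  (D.measurable_exit.comp (by fun_prop)).prodMk (by fun_prop)

open Classical in
/-- The law of the next post-jump location, given the present one, the pair of actions `(a, a_∂)`
and the interjump time `s`: it is `Q(φ(x,s), ℓ(x,a,s); ·)` if the jump occurs inside `E`, and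
`Q(φ(x,t_*(x)), a_∂; ·)` if it occurs at the boundary. (For `s = ∞` there is no further jump, and
the value plays no role.) -/
noncomputable def postJump : Kernel ((D.E × (U × U)) × ℝ≥0∞) D.E :=
  Kernel.piecewise D.measurableSet_lt_tstar
    (D.Q.comap (fun p => (D.flowE p.1.1 p.2.toNNReal, D.ell (p.1.1, p.1.2.1, p.2.toNNReal)))
      D.measurable_preJump)
    (D.Qb.comap (fun p => (D.exit p.1.1, p.1.2.2)) D.measurable_preJumpBoundary)

instance : IsMarkovKernel D.postJump := by
  unfold postJump; infer_instance

/-! ### Strategies -/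

/-- A randomized selector: a stochastic kernel `η` with `η(x; 𝕊(x)) = 1` for all `x ∈ E`. -/
structure Selector where
  ker : Kernel D.E (U × U)
  isMarkov_ker : IsMarkovKernel ker
  ker_S : ∀ x, ker x (D.S x) = 1

attribute [instance] Selector.isMarkov_ker

/-- An admissible randomized control strategy: the selector with index `k` is used after the
`k`-th jump. -/
abbrev Strategy := ℕ → D.Selector

/-- The stationary strategy `U^φ`. -/
def stationary (φ : D.Selector) : D.Strategy := fun _ => φ

/-! ### The controlled process -/

/-- The `k`-th record of the process: the interjump time `T_k - T_{k-1}` (for `k = 0` it is `0`),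
the post-jump location `Z_k` and the pair of actions `Θ_k = (θ_k, θ_{k,∂})`. -/
abbrev Rec := (ℝ≥0∞ × D.E) × (U × U)

/-- The law of the next record, given the present location and actions, when the next actions are
chosen by `η`. -/
noncomputable def step (η : D.Selector) : Kernel (D.E × (U × U)) D.Rec :=
  (D.sojourn.comap (fun p : D.E × (U × U) => (p.1, p.2.1)) (by fun_prop) ⊗ₖ D.postJump) ⊗ₖ
    η.ker.comap (fun p : (D.E × (U × U)) × (ℝ≥0∞ × D.E) => p.2.2) (by fun_prop)

instance (η : D.Selector) : IsMarkovKernel (D.step η) := by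
  unfold step; infer_instance

/-- The transition law of the records up to time `k` to the record `k + 1`. -/
noncomputable def trans (u : D.Strategy) (k : ℕ) :
    Kernel ((i : Finset.Iic k) → (fun _ : ℕ => D.Rec) i) D.Rec :=
  (D.step (u (k + 1))).comap
    (fun h => ((h ⟨k, Finset.mem_Iic.mpr le_rfl⟩).1.2, (h ⟨k, Finset.mem_Iic.mpr le_rfl⟩).2))
    (by fun_prop)

instance (u : D.Strategy) (k : ℕ) : IsMarkovKernel (D.trans u k) := by
  unfold trans; infer_instance

/-- The probability `P^U_{ν₀}` on the space of sequences of records. -/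
noncomputable def prob (ν₀ : Measure D.E) (u : D.Strategy) : Measure (ℕ → D.Rec) :=
  Kernel.trajMeasure (X := fun _ : ℕ => D.Rec)
    ((ν₀ ⊗ₘ (u 0).ker).map fun p => ((0, p.1), p.2)) (D.trans u)

variable {D}

/-- The `k`-th jump time `T_k`, with `T_0 = 0`. -/
noncomputable def T (k : ℕ) (ω : ℕ → D.Rec) : ℝ≥0∞ :=
  ∑ i ∈ Finset.range k, (ω (i + 1)).1.1

/-- `T_∞ = lim T_k`. -/
noncomputable def Tinf (ω : ℕ → D.Rec) : ℝ≥0∞ := ⨆ k, T k ω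

/-- The post-jump location `Z_k`. -/
def Z (k : ℕ) (ω : ℕ → D.Rec) : D.E := (ω k).1.2

/-- The pair of actions `Θ_k = (θ_k, θ_{k,∂})`. -/
def Θ (k : ℕ) (ω : ℕ → D.Rec) : U × U := (ω k).2

/-- The number `N(t)` of jumps up to time `t`. -/
noncomputable def N (t : ℝ≥0) (ω : ℕ → D.Rec) : ℕ := Set.ncard {i : ℕ | 1 ≤ i ∧ T i ω ≤ t}

/-- The number `N(t-)` of jumps strictly before time `t`. -/
noncomputable def Nminus (t : ℝ≥0) (ω : ℕ → D.Rec) : ℕ := Set.ncard {i : ℕ | 1 ≤ i ∧ T i ω < t}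

/-- The trajectory `X(t)`, `t < T_∞`: it follows the flow from the last post-jump location. -/
noncomputable def X (t : ℝ≥0) (ω : ℕ → D.Rec) : EuclideanSpace ℝ (Fin d) :=
  D.flow (Z (N t ω) ω) (t - T (N t ω) ω).toNNReal

/-- The left limit `X(t-)`, `t > 0`. -/
noncomputable def Xminus (t : ℝ≥0) (ω : ℕ → D.Rec) : EuclideanSpace ℝ (Fin d) :=
  D.flow (Z (Nminus t ω) ω) (t - T (Nminus t ω) ω).toNNReal

open Classical in
/-- The process `p*` that counts the jumps from the boundary, as a measure on the time axis. -/
noncomputable def pstar (ω : ℕ → D.Rec) : Measure ℝ≥0 :=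
  Measure.sum fun i : ℕ =>
    if T (i + 1) ω < ⊤ ∧ Xminus (T (i + 1) ω).toNNReal ω ∈ frontier D.E then
      Measure.dirac (T (i + 1) ω).toNNReal else 0

open Classical in
/-- Extension by `0` of a function on `A × U` to the ambient space. -/
noncomputable def ext {A : Set (EuclideanSpace ℝ (Fin d))} (g : A × U → ℝ≥0)
    (y : EuclideanSpace ℝ (Fin d)) (a : U) : ℝ≥0∞ :=
  if h : y ∈ A then (g (⟨y, h⟩, a) : ℝ≥0∞) else 0

variable {m : ℕ} (C : PDMPCosts D m) (α : ℝ≥0) (ν₀ : Measure D.E)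

/-- The discounted cost `J_i^α(U,t)` up to time `t ∈ [0,∞]`, on a trajectory. -/
noncomputable def J (i : Fin (m + 1)) (t : ℝ≥0∞) (ω : ℕ → D.Rec) : ℝ≥0∞ :=
  (∫⁻ s in {s : ℝ≥0 | (s : ℝ≥0∞) < t},
    expNeg (α * s) * ext (C.f i) (X s ω) (Θ (N s ω) ω).1 ∂leb) +
  ∫⁻ s in {s : ℝ≥0 | 0 < s ∧ (s : ℝ≥0∞) ≤ t},
    expNeg (α * s) * ext (C.r i) (Xminus s ω) (Θ (Nminus s ω) ω).2 ∂(pstar ω)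

/-- The infinite-horizon expected discounted cost `𝒟_i^α(U,ν₀) = E[J_i^α(U,T_∞)]`. -/
noncomputable def cost (i : Fin (m + 1)) (u : D.Strategy) : ℝ≥0∞ :=
  ∫⁻ ω, J C α i (Tinf ω) ω ∂(D.prob ν₀ u)

/-- The strategy satisfies the constraints `𝒟_i^α(U,ν₀) ≤ d_i`, `i = 1, …, m`. -/
def Satisfies (u : D.Strategy) : Prop :=
  ∀ i : Fin m, (cost C α ν₀ i.succ u : EReal) ≤ (C.lim i : EReal)

/-- The constrained discounted value `𝒥_𝒟^α(ν₀)` (`∞` if no strategy satisfies the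
constraints). -/
noncomputable def value : ℝ≥0∞ :=
  ⨅ (u : D.Strategy) (_ : Satisfies C α ν₀ u), cost C α ν₀ 0 u

/-- The class `𝒰_f` of feasible strategies. -/
def FeasibleStrategy (u : D.Strategy) : Prop :=
  cost C α ν₀ 0 u < ⊤ ∧ Satisfies C α ν₀ u

/-! ### The operators `G`, `L`, `H` -/

/-- The weight `e^{-αs - Λ^a(x,s)}`. -/
noncomputable def wt (D : PDMP d U V) (α : ℝ≥0) (x : D.E) (a : U) (s : ℝ≥0∞) : ℝ≥0∞ :=
  expNeg (α * s + D.Lam x a s)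

/-- The kernel `G(x,(a,a_∂); A)`. -/
noncomputable def G (p : D.E × (U × U)) (A : Set D.E) : ℝ≥0∞ :=
  (∫⁻ s in {s : ℝ≥0 | (s : ℝ≥0∞) < D.tstar p.1},
    wt D α p.1 p.2.1 s * D.lam (D.flowE p.1 s, D.ell (p.1, p.2.1, s)) *
      D.Q (D.flowE p.1 s, D.ell (p.1, p.2.1, s)) A ∂leb) +
  wt D α p.1 p.2.1 (D.tstar p.1) * D.Qb (D.exit p.1, p.2.2) A

/-- `Lh(x,(a,a_∂))` for `h` on `E × U` with values in `[0,∞]`. -/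
noncomputable def L (h : D.E × U → ℝ≥0∞) (p : D.E × (U × U)) : ℝ≥0∞ :=
  ∫⁻ s in {s : ℝ≥0 | (s : ℝ≥0∞) < D.tstar p.1},
    wt D α p.1 p.2.1 s * h (D.flowE p.1 s, p.2.1) ∂leb

/-- `Hg(x,(a,a_∂))` for `g` on `∂E × U`. -/
noncomputable def H (g : frontier D.E × U → ℝ≥0∞) (p : D.E × (U × U)) : ℝ≥0∞ :=
  wt D α p.1 p.2.1 (D.tstar p.1) * g (D.exit p.1, p.2.2)

/-- The one-stage cost `L f_i + H r_i`. -/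
noncomputable def stage (i : Fin (m + 1)) (p : D.E × (U × U)) : ℝ≥0∞ :=
  L α (fun q => (C.f i q : ℝ≥0∞)) p + H α (fun q => (C.r i q : ℝ≥0∞)) p

/-- `h(x,η) = ∫ h(x,â) η(x;dâ)`. -/
noncomputable def avg (h : D.E × (U × U) → ℝ≥0∞) (η : D.Selector) (x : D.E) : ℝ≥0∞ :=
  ∫⁻ a in D.S x, h (x, a) ∂(η.ker x)

/-! ### Standing assumptions -/

/-- Bounds on the jump rate. -/
def RateBounds (D : PDMP d U V) : Prop :=
  ∃ (lamUp lamLow : D.E → ℝ≥0) (Kl : ℝ≥0), Measurable lamUp ∧ Measurable lamLow ∧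
    (∀ x v, D.lam (x, v) ≤ lamUp x) ∧
    (∀ (x : D.E) (t : ℝ≥0), (t : ℝ≥0∞) < D.tstar x →
      ∫⁻ s in {s : ℝ≥0 | s ≤ t}, (lamUp (D.flowE x s) : ℝ≥0∞) ∂leb < ⊤) ∧
    (∀ x : D.E, D.tstar x < ⊤ →
      ∫⁻ s in {s : ℝ≥0 | (s : ℝ≥0∞) < D.tstar x}, (lamUp (D.flowE x s) : ℝ≥0∞) ∂leb < ⊤) ∧
    (∀ x v, lamLow x ≤ D.lam (x, v)) ∧ (∀ x, 0 < lamLow x) ∧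
    (∀ x : D.E, ∫⁻ t in {t : ℝ≥0 | (t : ℝ≥0∞) < D.tstar x},
      expNeg (∫⁻ s in {s : ℝ≥0 | s ≤ t}, (lamLow (D.flowE x s) : ℝ≥0∞) ∂leb) ∂leb ≤ Kl)

/-- `l = v(φ(x,t_*(x)))`, the limit of `v` along the flow at the boundary (`t_*(x) < ∞`). -/
def IsBoundaryValue (v : D.E → ℝ) (x : D.E) (l : ℝ) : Prop :=
  Tendsto (fun t : ℝ≥0 => v (D.flowE x t)) (𝓝[<] (D.tstar x).toNNReal) (𝓝 l)

/-- The class `𝕄^{ac}(E)`: measurable functions that are absolutely continuous along the flow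
(on the compact subintervals of `[0,t_*(x))`), with a limit towards the boundary. -/
def Mac (v : D.E → ℝ) : Prop :=
  Measurable v ∧
  (∀ (x : D.E) (t : ℝ≥0), (t : ℝ≥0∞) < D.tstar x →
    AbsolutelyContinuousOnInterval (fun s : ℝ => v (D.flowE x s.toNNReal)) 0 t) ∧
  ∀ x : D.E, D.tstar x < ⊤ → ∃ l : ℝ, IsBoundaryValue v x l

/-- `Xv` is a version of `𝒳v`, the derivative of `v` along the flow. -/
def IsFlowDerivative (v Xv : D.E → ℝ) : Prop :=
  Measurable Xv ∧
  ∀ (x : D.E) (t : ℝ≥0), (t : ℝ≥0∞) < D.tstar x →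
    IntegrableOn (fun s : ℝ≥0 => Xv (D.flowE x s)) {s | s ≤ t} leb ∧
    v (D.flowE x t) - v x = ∫ s in {s : ℝ≥0 | s ≤ t}, Xv (D.flowE x s) ∂leb

/-- The function `w = c₀ + L f₀ + H r₀`. -/
noncomputable def w (c₀ : ℝ≥0) (p : D.E × (U × U)) : ℝ≥0∞ := c₀ + stage C α 0 p

/-- The function `w₀(x) = inf_{â ∈ 𝕊(x)} w(x,â)`. -/
noncomputable def w₀ (c₀ : ℝ≥0) (x : D.E) : ℝ≥0∞ := ⨅ a ∈ D.S x, w C α c₀ (x, a)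

/-- The expected growth condition. -/
def Growth (c₀ : ℝ≥0) : Prop :=
  (Measurable (fun p : D.K => w C α c₀ p) ∧ (∀ p ∈ D.K, w C α c₀ p < ⊤) ∧
    Measurable (w₀ C α c₀) ∧ ∀ x, w₀ C α c₀ x < ⊤) ∧
  ∃ (b : D.E → ℝ) (c : ℝ) (v Xv : D.E → ℝ),
    Measurable b ∧ -(α : ℝ) < c ∧ Mac v ∧ (∀ x, 0 ≤ v x) ∧
    (∃ M : ℝ≥0, ∀ x, ENNReal.ofReal (v x) ≤ M * w₀ C α c₀ x) ∧
    IsFlowDerivative v Xv ∧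
    ∀ (x : D.E) (a : U × U), a ∈ D.S x →
      L α (fun q => ENNReal.ofReal (b q.1)) (x, a) < ⊤ ∧
      L α (fun q => ENNReal.ofReal (-b q.1)) (x, a) < ⊤ ∧
      (∀ t : ℝ≥0, (t : ℝ≥0∞) < D.tstar x →
        Integrable v (D.Q (D.flowE x t, D.ell (x, a.1, t))) ∧
        Xv (D.flowE x t) + c * v (D.flowE x t) -
          D.lam (D.flowE x t, D.ell (x, a.1, t)) *
            (v (D.flowE x t) - ∫ y, v y ∂(D.Q (D.flowE x t, D.ell (x, a.1, t)))) ≤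
          b (D.flowE x t) ∧
        D.lam (D.flowE x t, D.ell (x, a.1, t)) + 1 / (c + α) * b (D.flowE x t) ≤
          v (D.flowE x t)) ∧
      (D.tstar x < ⊤ → Integrable v (D.Qb (D.exit x, a.2)) ∧
        ∀ l : ℝ, IsBoundaryValue v x l →
          (∫ y, v y ∂(D.Qb (D.exit x, a.2))) + c + α ≤ l)

/-! ### The linear program -/

/-- The occupation measure `μ^U_{ν₀}(Γ) = ∑_k E[e^{-α T_k} 1_Γ(Z_k,Θ_k)]`. -/
noncomputable def occ (u : D.Strategy) : Measure (D.E × (U × U)) :=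
  Measure.sum fun k : ℕ =>
    ((D.prob ν₀ u).withDensity fun ω => expNeg (α * T k ω)).map fun ω => (Z k ω, Θ k ω)

/-- `μ ∈ ℳ_w(𝒦)_+`: a finite positive measure on `𝒦` (that is, carried by `𝒦`) that
integrates `w`. -/
def MwK (c₀ : ℝ≥0) (μ : Measure (D.E × (U × U))) : Prop :=
  IsFiniteMeasure μ ∧ μ D.Kᶜ = 0 ∧ ∫⁻ p in D.K, w C α c₀ p ∂μ < ⊤

/-- The feasible set `𝐋` of the linear program. -/
def FeasibleMeasure (c₀ : ℝ≥0) (μ : Measure (D.E × (U × U))) : Prop :=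
  MwK C α c₀ μ ∧
  (∀ B : Set D.E, MeasurableSet B → μ.fst B = ν₀ B + ∫⁻ p in D.K, G α p B ∂μ) ∧
  ∀ i : Fin m, ((∫⁻ p in D.K, stage C α i.succ p ∂μ : ℝ≥0∞) : EReal) ≤ (C.lim i : EReal)

/-- The infimum of the linear program. -/
noncomputable def lpValue (c₀ : ℝ≥0) : ℝ≥0∞ :=
  ⨅ (μ : Measure (D.E × (U × U))) (_ : FeasibleMeasure C α ν₀ c₀ μ),
    ∫⁻ p in D.K, stage C α 0 p ∂μ

end PDMP

/-! Both problems are linear in the same object. Conditioning on the `k`-th jump time, location and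
actions turns the cost of a stage into `L f_i + H r_i`, so the cost of a strategy is the integral of
the stage cost over its occupation measure (`cost_eq_lintegral_occ`). This rests on the law of the
interjump time: density `λ e^{-Λ}` before `t_*` and the remaining mass as an atom at `t_*`
(`sojourn_eq`).

The discounted laws `disc k` of `(Z_k, Θ_k)` satisfy a recursion: apply `G` to `disc k`, then draw
the actions with the next selector (`disc_succ`). Summing over `k` gives the balance equation of the
linear program (`occ_fst`).

What remains is finiteness, and for the converse uniqueness. Eliminating `b` from the growth
condition and integrating along the flow against `e^{-αs-Λ}` gives a potential: `∫ (β + v) dG ≤ v`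
on `𝒦` with `β = c + α > 0` (`lintegral_Gker_le`, `Growth.exists_potential`). Along iterates of `G`
the integral of `v` thus drops at each step by at least `β` times the mass of the next iterate, so
the masses are summable as soon as the initial integral of `v` is finite; since `v ≤ M w₀`, a finite
integral of `w` is enough.

Applied to `disc k`, this makes the occupation measure of a strategy of finite cost finite, hence
feasible when the constraints hold. Conversely, disintegrate a feasible `μ` as its marginal followed
by a selector `φ` and iterate the balance equation: `μ` is the sum of the first `n` discounted laws
under `U^φ` plus a remainder, whose mass tends to `0` by the same estimate. Hence `μ` is the
occupation measure of `U^φ` (`occ_stationary_eq`) and has the same costs. The two passages give the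
equality of the values. -/

namespace PDMP

/-! ### Absolutely continuous exponentials -/

/-- The map `y ↦ e^{-y}` is 1-Lipschitz on `[0, ∞)`, so the `δ` of `f` serves unchanged. -/
lemma absolutelyContinuousOnInterval_exp_neg {f : ℝ → ℝ} {T : ℝ}
    (hf : AbsolutelyContinuousOnInterval f 0 T) (hf0 : ∀ t ∈ uIcc 0 T, 0 ≤ f t) :
    AbsolutelyContinuousOnInterval (fun t => Real.exp (-f t)) 0 T := by
  rw [absolutelyContinuousOnInterval_iff] at hf ⊢
  intro ε hε
  obtain ⟨δ, hδ, h⟩ := hf ε hε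
  refine ⟨δ, hδ, fun I hI hIδ => lt_of_le_of_lt (Finset.sum_le_sum fun i hi => ?_) (h I hI hIδ)⟩
  have hmem := hI.1 i hi
  have key : ∀ x y : ℝ, 0 ≤ x → x ≤ y → |Real.exp (-x) - Real.exp (-y)| ≤ |x - y| := by
    intro x y hx hxy
    have h1 : Real.exp (-y) ≤ Real.exp (-x) := Real.exp_le_exp.mpr (by linarith)
    rw [abs_of_nonneg (by linarith), abs_of_nonpos (by linarith)]
    have h2 : Real.exp (-y) = Real.exp (-x) * Real.exp (-(y - x)) := by
      rw [← Real.exp_add]; ring_nf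
    have h3 : 1 - (y - x) ≤ Real.exp (-(y - x)) := Real.one_sub_le_exp_neg _
    have h4 : Real.exp (-x) ≤ 1 := Real.exp_le_one_iff.mpr (by linarith)
    have h5 : Real.exp (-(y - x)) ≤ 1 := Real.exp_le_one_iff.mpr (by linarith)
    rw [h2]
    nlinarith [Real.exp_pos (-x)]
  rw [Real.dist_eq, Real.dist_eq]
  rcases le_total (f (I.2 i).1) (f (I.2 i).2) with h' | h'
  · exact key _ _ (hf0 _ hmem.1) h'
  · rw [abs_sub_comm, abs_sub_comm (f _)]
    exact key _ _ (hf0 _ hmem.2) h'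

/-- Product rule and fundamental theorem of calculus for absolutely continuous functions, with the
discount `e^{-∫g}` and a primitive of `u`. With `u` the flow derivative of `v` it yields the
potential inequality; with `u = 0`, `F₀ = 1` it yields the total mass of the interjump law. -/
lemma integral_exp_neg_mul {g u : ℝ → ℝ} {T F₀ : ℝ} (hT : 0 ≤ T)
    (hg : IntervalIntegrable g volume 0 T) (hu : IntervalIntegrable u volume 0 T)
    (hg0 : ∀ t ∈ Icc 0 T, 0 ≤ g t) :
    IntervalIntegrable (fun t => Real.exp (-∫ s in (0 : ℝ)..t, g s) *
      (u t - g t * (F₀ + ∫ s in (0 : ℝ)..t, u s))) volume 0 T ∧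
    ∫ t in (0 : ℝ)..T, Real.exp (-∫ s in (0 : ℝ)..t, g s) *
      (u t - g t * (F₀ + ∫ s in (0 : ℝ)..t, u s)) =
      Real.exp (-∫ s in (0 : ℝ)..T, g s) * (F₀ + ∫ s in (0 : ℝ)..T, u s) - F₀ := by
  have hAC : AbsolutelyContinuousOnInterval (fun t => ∫ s in (0 : ℝ)..t, g s) 0 T :=
    hg.absolutelyContinuousOnInterval_intervalIntegral (by simp)
  have hE := absolutelyContinuousOnInterval_exp_neg hAC (fun t ht => by
    rw [uIcc_of_le hT] at ht
    exact intervalIntegral.integral_nonneg ht.1 fun s hs => hg0 s ⟨hs.1, hs.2.trans ht.2⟩)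
  have hFu : AbsolutelyContinuousOnInterval (fun t => ∫ s in (0 : ℝ)..t, u s) 0 T :=
    hu.absolutelyContinuousOnInterval_intervalIntegral (by simp)
  have hc : AbsolutelyContinuousOnInterval (fun _ : ℝ => F₀) 0 T :=
    LipschitzOnWith.absolutelyContinuousOnInterval (K := 0) (LipschitzWith.const F₀).lipschitzOnWith
  have hF : AbsolutelyContinuousOnInterval (fun t => F₀ + ∫ s in (0 : ℝ)..t, u s) 0 T := hc.add hFu
  have hP := hE.fun_mul hF
  have hder : ∀ᵐ t, t ∈ uIoc 0 T →
      deriv (fun t => Real.exp (-∫ s in (0 : ℝ)..t, g s) * (F₀ + ∫ s in (0 : ℝ)..t, u s)) t =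
      Real.exp (-∫ s in (0 : ℝ)..t, g s) * (u t - g t * (F₀ + ∫ s in (0 : ℝ)..t, u s)) := by
    filter_upwards [hg.ae_hasDerivAt_integral, hu.ae_hasDerivAt_integral] with t h1 h2 ht
    have ht' := uIoc_subset_uIcc ht
    have e1 := (h1 ht' 0 (by simp)).neg.exp
    have e2 := (h2 ht' 0 (by simp)).const_add F₀
    have e3 := (e1.mul e2).deriv
    simp only [Pi.mul_def, Pi.neg_apply] at e3
    rw [e3]
    ring
  constructor
  · refine hP.intervalIntegrable_deriv.congr_ae ?_
    rw [EventuallyEq, ae_restrict_iff' measurableSet_uIoc]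
    exact hder
  · rw [← intervalIntegral.integral_congr_ae hder, hP.integral_deriv_eq_sub]
    simp

/-! ### Lebesgue measure on the half-line -/

lemma setLIntegral_leb {f : ℝ≥0 → ℝ≥0∞} (hf : Measurable f) {A : Set ℝ≥0} (hA : MeasurableSet A) :
    ∫⁻ s in A, f s ∂leb = ∫⁻ s in Real.toNNReal ⁻¹' A ∩ Ici 0, f s.toNNReal := by
  rw [leb, setLIntegral_map hA hf measurable_real_toNNReal,
    Measure.restrict_restrict (measurable_real_toNNReal hA)]

lemma measurableSet_le_coe (T : ℝ≥0) : MeasurableSet {s : ℝ≥0 | s ≤ T} :=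
  measurableSet_le measurable_id measurable_const

lemma setLIntegral_leb_Iic {f : ℝ≥0 → ℝ≥0∞} (hf : Measurable f) (T : ℝ≥0) :
    ∫⁻ s in {s | s ≤ T}, f s ∂leb = ∫⁻ s in Ioc 0 (T : ℝ), f s.toNNReal := by
  rw [setLIntegral_leb hf (measurableSet_le_coe T),
    Measure.restrict_congr_set (Ioc_ae_eq_Icc (a := (0 : ℝ)) (b := T))]
  congr 2
  ext s
  simp only [mem_inter_iff, mem_preimage, mem_ofPred_eq, mem_Ici, mem_Icc, Real.toNNReal_le_iff_le_coe]
  tauto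

instance : NullSingletonClass leb := by
  refine ⟨fun t => ?_⟩
  rw [leb, Measure.map_apply measurable_real_toNNReal (measurableSet_singleton t),
    Measure.restrict_apply (measurable_real_toNNReal (measurableSet_singleton t))]
  refine measure_mono_null (t := {(t : ℝ)}) ?_ (by simp)
  rintro s ⟨h1, h2⟩
  simp only [mem_preimage, mem_singleton_iff] at h1 ⊢
  rw [← h1, Real.coe_toNNReal _ h2]

lemma integrableOn_leb_Iic {f : ℝ≥0 → ℝ} (hf : Measurable f) (T : ℝ≥0) :
    IntegrableOn f {s | s ≤ T} leb ↔
      IntervalIntegrable (fun s : ℝ => f s.toNNReal) volume 0 T := by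
  rw [intervalIntegrable_iff_integrableOn_Ioc_of_le T.coe_nonneg]
  unfold IntegrableOn Integrable
  rw [and_iff_right hf.aestronglyMeasurable,
    and_iff_right (show AEStronglyMeasurable (fun s : ℝ => f s.toNNReal) _ from
      (hf.comp measurable_real_toNNReal).aestronglyMeasurable)]
  unfold HasFiniteIntegral
  rw [setLIntegral_leb_Iic (by fun_prop)]

lemma setIntegral_leb_Iic {f : ℝ≥0 → ℝ} (hf : Measurable f) (T : ℝ≥0) :
    ∫ s in {s | s ≤ T}, f s ∂leb = ∫ s in (0 : ℝ)..T, f s.toNNReal := by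
  rw [intervalIntegral.integral_of_le T.coe_nonneg, leb,
    setIntegral_map (measurableSet_le_coe T) hf.aestronglyMeasurable measurable_real_toNNReal.aemeasurable,
    Measure.restrict_restrict (measurable_real_toNNReal (measurableSet_le_coe T)),
    Measure.restrict_congr_set (Ioc_ae_eq_Icc (a := (0 : ℝ)) (b := T))]
  congr 2
  ext s
  simp only [mem_inter_iff, mem_preimage, mem_ofPred_eq, mem_Ici, mem_Icc, Real.toNNReal_le_iff_le_coe]
  tauto

lemma measurableSet_coe_lt (t : ℝ≥0∞) : MeasurableSet {s : ℝ≥0 | (s : ℝ≥0∞) < t} :=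
  measurableSet_lt measurable_coe_nnreal_ennreal measurable_const

lemma restrict_leb_lt (T : ℝ≥0) :
    leb.restrict {s : ℝ≥0 | (s : ℝ≥0∞) < T} = leb.restrict {s : ℝ≥0 | s ≤ T} := by
  have : {s : ℝ≥0 | (s : ℝ≥0∞) < T} = Iio T := by ext; simp
  rw [this]
  exact Measure.restrict_congr_set Iio_ae_eq_Iic

/-! ### The exponential on `[0,∞]` -/

/-- This form gives continuity on all of `[0, ∞]`, including at `∞`, as needed when `t` increases to
an exit time, or a cumulated rate to a limit, that may be infinite. -/
lemma expNeg_eq_exp (y : ℝ≥0∞) : expNeg y = EReal.exp (-(y : EReal)) := by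
  induction y using ENNReal.recTopCoe with
  | top => simp [expNeg]
  | coe y =>
    have : (-(((y : ℝ≥0∞) : EReal))) = ((-(y : ℝ) : ℝ) : EReal) := by
      rw [EReal.coe_neg]; rfl
    rw [this, EReal.exp_coe]
    simp [expNeg]

lemma continuous_expNeg : Continuous expNeg := by
  have : expNeg = fun y : ℝ≥0∞ => EReal.exp (-(y : EReal)) := funext expNeg_eq_exp
  rw [this]
  exact ENNReal.continuous_exp.comp (continuous_neg.comp continuous_coe_ennreal_ereal)

@[fun_prop]
lemma measurable_expNeg : Measurable expNeg := continuous_expNeg.measurable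

@[simp] lemma expNeg_zero : expNeg 0 = 1 := by simp [expNeg]

@[simp] lemma expNeg_top : expNeg ⊤ = 0 := by simp [expNeg]

lemma expNeg_add (x y : ℝ≥0∞) : expNeg (x + y) = expNeg x * expNeg y := by
  by_cases hx : x = ⊤
  · simp [hx]
  by_cases hy : y = ⊤
  · simp [hy]
  have hxy : x + y ≠ ⊤ := by simp [hx, hy]
  simp only [expNeg, hx, hy, hxy, if_false]
  rw [ENNReal.toReal_add hx hy, ← ENNReal.ofReal_mul (Real.exp_pos _).le, ← Real.exp_add]
  congr 2; ring

lemma expNeg_le_one (x : ℝ≥0∞) : expNeg x ≤ 1 := by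
  unfold expNeg
  split_ifs
  · simp
  · exact ENNReal.ofReal_le_one.mpr (Real.exp_le_one_iff.mpr (by simp))

lemma expNeg_ofReal {x : ℝ} (hx : 0 ≤ x) :
    expNeg (ENNReal.ofReal x) = ENNReal.ofReal (Real.exp (-x)) := by
  simp [expNeg, ENNReal.toReal_ofReal hx]

/-! ### Cumulated rates -/

/-- The cumulated rate `∫_0^t ρ(s) ds`. -/
noncomputable def cum (ρ : ℝ≥0 → ℝ≥0) (t : ℝ≥0∞) : ℝ≥0∞ :=
  ∫⁻ s in {s : ℝ≥0 | (s : ℝ≥0∞) < t}, (ρ s : ℝ≥0∞) ∂leb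

lemma cum_mono (ρ : ℝ≥0 → ℝ≥0) : Monotone (cum ρ) := fun _ _ hst =>
  lintegral_mono_set fun _ hu => lt_of_lt_of_le hu hst

lemma measurable_cum (ρ : ℝ≥0 → ℝ≥0) : Measurable (cum ρ) := (cum_mono ρ).measurable

lemma cum_coe (ρ : ℝ≥0 → ℝ≥0) (t : ℝ≥0) :
    cum ρ t = ∫⁻ s in {s : ℝ≥0 | s ≤ t}, (ρ s : ℝ≥0∞) ∂leb := by
  rw [cum, restrict_leb_lt]

lemma intervalIntegrable_of_cum {ρ : ℝ≥0 → ℝ≥0} (hρ : Measurable ρ) {T : ℝ≥0} (h : cum ρ T < ⊤) :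
    IntervalIntegrable (fun s : ℝ => (ρ s.toNNReal : ℝ)) volume 0 T := by
  rw [← integrableOn_leb_Iic (f := fun s => (ρ s : ℝ)) (by fun_prop)]
  refine ⟨(by fun_prop : Measurable fun s => (ρ s : ℝ)).aestronglyMeasurable, ?_⟩
  rw [cum_coe] at h
  simpa [HasFiniteIntegral] using h

lemma cum_eq_ofReal {ρ : ℝ≥0 → ℝ≥0} (hρ : Measurable ρ) {T : ℝ≥0} (h : cum ρ T < ⊤) {t : ℝ}
    (ht : t ∈ Icc 0 (T : ℝ)) :
    cum ρ t.toNNReal = ENNReal.ofReal (∫ s in (0 : ℝ)..t, (ρ s.toNNReal : ℝ)) := by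
  have h' : cum ρ t.toNNReal < ⊤ := lt_of_le_of_lt (cum_mono ρ (by
    exact_mod_cast Real.toNNReal_le_iff_le_coe.mpr ht.2)) h
  have hi := intervalIntegrable_of_cum hρ h'
  rw [Real.coe_toNNReal _ ht.1, intervalIntegrable_iff_integrableOn_Ioc_of_le ht.1] at hi
  rw [intervalIntegral.integral_of_le ht.1,
    ofReal_integral_eq_lintegral_ofReal hi (ae_of_all _ fun s => by positivity), cum_coe,
    setLIntegral_leb_Iic (by fun_prop), Real.coe_toNNReal _ ht.1]
  simp

lemma expNeg_cum {ρ : ℝ≥0 → ℝ≥0} (hρ : Measurable ρ) {T : ℝ≥0} (h : cum ρ T < ⊤) {t : ℝ}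
    (ht : t ∈ Icc 0 (T : ℝ)) :
    expNeg (cum ρ t.toNNReal) =
      ENNReal.ofReal (Real.exp (-∫ s in (0 : ℝ)..t, (ρ s.toNNReal : ℝ))) := by
  rw [cum_eq_ofReal hρ h ht, expNeg_ofReal
    (intervalIntegral.integral_nonneg ht.1 fun s _ => by positivity)]

/-- Integrated form of a differential inequality `v' - ρ v ≤ -q`, discounted at the rate `ρ`. -/
lemma expNeg_cum_mul_add_lintegral_le {ρ q : ℝ≥0 → ℝ≥0} (hρ : Measurable ρ) (hq : Measurable q)
    {T : ℝ≥0} (hT : cum ρ T < ⊤) {v u : ℝ≥0 → ℝ} (hu : Measurable u)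
    (hui : IntegrableOn u {s | s ≤ T} leb)
    (hv : ∀ t ≤ T, v t - v 0 = ∫ s in {s : ℝ≥0 | s ≤ t}, u s ∂leb) (hvT : 0 ≤ v T)
    (hle : ∀ t ≤ T, u t - ρ t * v t ≤ -q t) :
    expNeg (cum ρ T) * ENNReal.ofReal (v T) +
      ∫⁻ s in {s : ℝ≥0 | (s : ℝ≥0∞) < T}, expNeg (cum ρ s) * q s ∂leb ≤ ENNReal.ofReal (v 0) := by
  have hui' := (integrableOn_leb_Iic hu T).mp hui
  have hg := intervalIntegrable_of_cum hρ hT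
  obtain ⟨hI, hEq⟩ := integral_exp_neg_mul (F₀ := v 0) T.coe_nonneg hg hui' (fun _ _ => by positivity)
  have hF : ∀ t ∈ Icc 0 (T : ℝ), v 0 + ∫ s in (0 : ℝ)..t, u s.toNNReal = v t.toNNReal := by
    intro t ht
    have := hv t.toNNReal (Real.toNNReal_le_iff_le_coe.mpr ht.2)
    rw [setIntegral_leb_Iic hu, Real.coe_toNNReal _ ht.1] at this
    linarith
  have hET := expNeg_cum hρ hT (t := T) ⟨T.coe_nonneg, le_rfl⟩
  rw [Real.toNNReal_coe] at hET
  have hFT := hF T ⟨T.coe_nonneg, le_rfl⟩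
  rw [Real.toNNReal_coe] at hFT
  rw [hFT, intervalIntegral.integral_of_le T.coe_nonneg] at hEq
  rw [intervalIntegrable_iff_integrableOn_Ioc_of_le T.coe_nonneg] at hI
  have hI' := hI.neg
  simp only [Pi.neg_def] at hI'
  -- The integrand on the right is minus the derivative of the discounted `v`; the differential
  -- inequality bounds it below by the discounted `q`.
  have hneg : ∀ t ∈ Ioc 0 (T : ℝ), Real.exp (-∫ s in (0 : ℝ)..t, (ρ s.toNNReal : ℝ)) * q t.toNNReal ≤
      -(Real.exp (-∫ s in (0 : ℝ)..t, (ρ s.toNNReal : ℝ)) *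
      (u t.toNNReal - ρ t.toNNReal * (v 0 + ∫ s in (0 : ℝ)..t, u s.toNNReal))) := by
    intro t ht
    rw [hF t ⟨ht.1.le, ht.2⟩, ← mul_neg]
    refine mul_le_mul_of_nonneg_left ?_ (Real.exp_pos _).le
    linarith [hle t.toNNReal (Real.toNNReal_le_iff_le_coe.mpr ht.2)]
  have hint : ∫⁻ s in {s : ℝ≥0 | (s : ℝ≥0∞) < T}, expNeg (cum ρ s) * q s ∂leb ≤
      ENNReal.ofReal (v 0 - Real.exp (-∫ s in (0 : ℝ)..T, (ρ s.toNNReal : ℝ)) * v T) := by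
    have : v 0 - Real.exp (-∫ s in (0 : ℝ)..T, (ρ s.toNNReal : ℝ)) * v T =
        ∫ t in Ioc 0 (T : ℝ), -(Real.exp (-∫ s in (0 : ℝ)..t, (ρ s.toNNReal : ℝ)) *
      (u t.toNNReal - ρ t.toNNReal * (v 0 + ∫ s in (0 : ℝ)..t, u s.toNNReal))) := by
      rw [integral_neg, hEq]; ring
    rw [this, ofReal_integral_eq_lintegral_ofReal hI', restrict_leb_lt, setLIntegral_leb_Iic]
    · refine setLIntegral_mono' measurableSet_Ioc fun t ht => ?_
      rw [expNeg_cum hρ hT ⟨ht.1.le, ht.2⟩, ← ENNReal.ofReal_coe_nnreal,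
        ← ENNReal.ofReal_mul (Real.exp_pos _).le]
      exact ENNReal.ofReal_le_ofReal (hneg t ht)
    · have := measurable_cum ρ
      fun_prop
    · rw [EventuallyLE, ae_restrict_iff' measurableSet_Ioc]
      exact ae_of_all _ fun t ht => le_trans (by positivity) (hneg t ht)
  -- Needed because `ENNReal.ofReal` truncates negative numbers: the difference has to be
  -- nonnegative for the two terms to add up to `v 0`.
  have hle' : Real.exp (-∫ s in (0 : ℝ)..T, (ρ s.toNNReal : ℝ)) * v T ≤ v 0 := by
    have : 0 ≤ v 0 - Real.exp (-∫ s in (0 : ℝ)..T, (ρ s.toNNReal : ℝ)) * v T := by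
      have h0 : (0 : ℝ) ≤ ∫ t in Ioc 0 (T : ℝ), -(Real.exp (-∫ s in (0 : ℝ)..t, (ρ s.toNNReal : ℝ)) *
      (u t.toNNReal - ρ t.toNNReal * (v 0 + ∫ s in (0 : ℝ)..t, u s.toNNReal))) :=
        setIntegral_nonneg measurableSet_Ioc fun t ht => le_trans (by positivity) (hneg t ht)
      rw [integral_neg, hEq] at h0
      linarith
    linarith
  calc _ ≤ ENNReal.ofReal (Real.exp (-∫ s in (0 : ℝ)..T, (ρ s.toNNReal : ℝ)) * v T) +
        ENNReal.ofReal (v 0 - Real.exp (-∫ s in (0 : ℝ)..T, (ρ s.toNNReal : ℝ)) * v T) := by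
        rw [hET, ← ENNReal.ofReal_mul (Real.exp_pos _).le]
        gcongr
    _ = _ := by
        rw [← ENNReal.ofReal_add (by positivity) (by linarith)]
        congr 1; ring

lemma lintegral_expNeg_cum_add {ρ : ℝ≥0 → ℝ≥0} (hρ : Measurable ρ) {T : ℝ≥0} (hT : cum ρ T < ⊤) :
    ∫⁻ s in {s : ℝ≥0 | s ≤ T}, expNeg (cum ρ s) * ρ s ∂leb + expNeg (cum ρ T) = 1 := by
  have hg := intervalIntegrable_of_cum hρ hT
  obtain ⟨hI, hEq⟩ := integral_exp_neg_mul (F₀ := 1) (u := fun _ => 0) T.coe_nonneg hg (by simp)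
    (fun _ _ => by positivity)
  have hET := expNeg_cum hρ hT (t := T) ⟨T.coe_nonneg, le_rfl⟩
  rw [Real.toNNReal_coe] at hET
  simp only [intervalIntegral.integral_zero, add_zero, mul_one, zero_sub, mul_neg,
    intervalIntegral.integral_neg] at hEq hI
  rw [intervalIntegral.integral_of_le T.coe_nonneg] at hEq
  have hI' : IntervalIntegrable (fun t => Real.exp (-∫ s in (0 : ℝ)..t, (ρ s.toNNReal : ℝ)) *
      ρ t.toNNReal) volume 0 T := by simpa [Pi.neg_def] using hI.neg
  rw [intervalIntegrable_iff_integrableOn_Ioc_of_le T.coe_nonneg] at hI'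
  rw [setLIntegral_leb_Iic, hET]
  · have : ∫⁻ s in Ioc 0 (T : ℝ), expNeg (cum ρ s.toNNReal) * ρ s.toNNReal =
        ENNReal.ofReal (∫ t in Ioc 0 (T : ℝ),
          Real.exp (-∫ s in (0 : ℝ)..t, (ρ s.toNNReal : ℝ)) * ρ t.toNNReal) := by
      rw [ofReal_integral_eq_lintegral_ofReal hI' (ae_of_all _ fun t => by positivity)]
      refine setLIntegral_congr_fun measurableSet_Ioc fun t ht => ?_
      rw [expNeg_cum hρ hT ⟨ht.1.le, ht.2⟩, ENNReal.ofReal_mul (Real.exp_pos _).le,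
        ENNReal.ofReal_coe_nnreal]
    rw [this, ← ENNReal.ofReal_add
      (setIntegral_nonneg measurableSet_Ioc fun t ht => by positivity) (Real.exp_pos _).le,
      ← ENNReal.ofReal_one]
    congr 1
    linarith
  · have := measurable_cum ρ
    fun_prop

/-- Left-continuity of integrals over `[0, τ)` in the upper limit `τ`. -/
lemma exists_seq_tendsto_setLIntegral {τ : ℝ≥0∞} (hτ : 0 < τ) :
    ∃ t : ℕ → ℝ≥0, (∀ n, 0 < t n ∧ (t n : ℝ≥0∞) < τ) ∧
      Tendsto (fun n => (t n : ℝ≥0∞)) atTop (𝓝 τ) ∧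
      ∀ f : ℝ≥0 → ℝ≥0∞, Tendsto (fun n => ∫⁻ s in {s : ℝ≥0 | (s : ℝ≥0∞) < t n}, f s ∂leb) atTop
        (𝓝 (∫⁻ s in {s : ℝ≥0 | (s : ℝ≥0∞) < τ}, f s ∂leb)) := by
  obtain ⟨w, hw, hwlt, hwt⟩ := exists_seq_strictMono_tendsto' hτ
  have hne : ∀ n, w n ≠ ⊤ := fun n => ((hwlt n).2.trans_le le_top).ne
  refine ⟨fun n => (w n).toNNReal, fun n => ?_, ?_, fun f => ?_⟩
  · rw [ENNReal.coe_toNNReal (hne n)]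
    exact ⟨ENNReal.toNNReal_pos (hwlt n).1.ne' (hne n), (hwlt n).2⟩
  · simpa only [ENNReal.coe_toNNReal (hne _)] using hwt
  · simp only [ENNReal.coe_toNNReal (hne _)]
    have hmono : Monotone fun n => {s : ℝ≥0 | (s : ℝ≥0∞) < w n} := fun i j hij s hs =>
      lt_of_lt_of_le hs (hw.monotone hij)
    have hU : {s : ℝ≥0 | (s : ℝ≥0∞) < τ} = ⋃ n, {s : ℝ≥0 | (s : ℝ≥0∞) < w n} := by
      ext s
      simp only [mem_ofPred_eq, mem_iUnion]
      exact ⟨fun h => (hwt.eventually (lt_mem_nhds h)).exists, fun ⟨n, h⟩ => h.trans (hwlt n).2⟩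
    have := tendsto_measure_iUnion_atTop (μ := leb.withDensity f) hmono
    rw [← hU] at this
    simpa [withDensity_apply _ (measurableSet_coe_lt _), Function.comp_def] using this

/-- Limit of the finite-horizon identity as the horizon increases to `τ`. Both `τ` and the cumulated
rate up to `τ` may be infinite; in the latter case the second term is `0`. -/
lemma setLIntegral_expNeg_cum_add {ρ : ℝ≥0 → ℝ≥0} (hρ : Measurable ρ) {τ : ℝ≥0∞} (hτ : 0 < τ)
    (hfin : ∀ t : ℝ≥0, (t : ℝ≥0∞) < τ → cum ρ t < ⊤) :
    ∫⁻ s in {s : ℝ≥0 | (s : ℝ≥0∞) < τ}, expNeg (cum ρ s) * ρ s ∂leb + expNeg (cum ρ τ) = 1 := by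
  obtain ⟨t, ht, -, hlim⟩ := exists_seq_tendsto_setLIntegral hτ
  have h1 := hlim fun s => expNeg (cum ρ s) * ρ s
  have h2 : Tendsto (fun n => expNeg (cum ρ (t n))) atTop (𝓝 (expNeg (cum ρ τ))) :=
    (continuous_expNeg.tendsto _).comp (hlim fun s => (ρ s : ℝ≥0∞))
  refine tendsto_nhds_unique (h1.add h2) ?_
  refine tendsto_const_nhds.congr fun n => ?_
  rw [restrict_leb_lt, lintegral_expNeg_cum_add hρ (hfin _ (ht n).2)]

end PDMP

namespace PDMP

variable {d : ℕ} {U V : Type*} [MeasurableSpace U] [MeasurableSpace V] (D : PDMP d U V)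

/-! ### The flow up to the exit time -/

lemma tstar_pos (x : D.E) : 0 < D.tstar x := by
  rw [pos_iff_ne_zero]
  intro h
  obtain ⟨t, ht, hF⟩ := (D.tstar_le_iff x 0).mp (by simp [h])
  obtain rfl : t = 0 := le_antisymm ht.2 ht.1
  rw [D.flow_zero, D.isOpen_E.frontier_eq] at hF
  exact hF.2 x.2

/-- Connectedness: up to time `t` the trajectory avoids the frontier, so it is covered by the
disjoint open sets `E` and the exterior of `E`, and it starts in `E`. -/
lemma flow_mem (x : D.E) {t : ℝ≥0} (ht : (t : ℝ≥0∞) < D.tstar x) : D.flow x t ∈ D.E := by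
  by_contra hn
  have hc : Continuous fun t : ℝ≥0 => D.flow x t :=
    D.continuous_flow.comp (by fun_prop : Continuous fun t : ℝ≥0 => ((x : EuclideanSpace ℝ (Fin d)), t))
  have hpre : IsPreconnected ((fun t : ℝ≥0 => D.flow x t) '' Icc 0 t) :=
    isPreconnected_Icc.image _ hc.continuousOn
  have hnF : ∀ s ∈ Icc 0 t, D.flow x s ∉ frontier D.E := fun s hs hF =>
    absurd ((D.tstar_le_iff x t).mpr ⟨s, hs, hF⟩) (not_le.mpr ht)
  have hcl : ∀ s ∈ Icc 0 t, D.flow x s ∉ D.E → D.flow x s ∈ (closure D.E)ᶜ := fun s hs hE hC =>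
    hnF s hs (by rw [D.isOpen_E.frontier_eq]; exact ⟨hC, hE⟩)
  obtain ⟨y, -, hy1, hy2⟩ := hpre D.E (closure D.E)ᶜ D.isOpen_E isClosed_closure.isOpen_compl
    (by rintro _ ⟨s, hs, rfl⟩; exact or_iff_not_imp_left.mpr (hcl s hs))
    ⟨x, ⟨0, by simp, D.flow_zero x⟩, x.2⟩ ⟨_, ⟨t, by simp, rfl⟩, hcl t (by simp) hn⟩
  exact hy2 (subset_closure hy1)

lemma coe_flowE (x : D.E) {t : ℝ≥0} (ht : (t : ℝ≥0∞) < D.tstar x) :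
    (D.flowE x t : EuclideanSpace ℝ (Fin d)) = D.flow x t := by
  rw [flowE, dif_pos (D.flow_mem x ht)]

lemma flowE_zero (x : D.E) : D.flowE x 0 = x := by
  apply Subtype.ext
  rw [D.coe_flowE x (by simpa using D.tstar_pos x), D.flow_zero]

lemma flow_tstar_mem (x : D.E) (h : D.tstar x ≠ ⊤) :
    D.flow x (D.tstar x).toNNReal ∈ frontier D.E := by
  obtain ⟨t, ht, hF⟩ := (D.tstar_le_iff x (D.tstar x).toNNReal).mp (by rw [ENNReal.coe_toNNReal h])
  have h1 : D.tstar x ≤ t := (D.tstar_le_iff x t).mpr ⟨t, by simp, hF⟩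
  have h2 : (D.tstar x).toNNReal ≤ t := by
    rwa [← ENNReal.coe_le_coe, ENNReal.coe_toNNReal h]
  rwa [le_antisymm h2 ht.2]

lemma coe_exit (x : D.E) (h : D.tstar x ≠ ⊤) :
    (D.exit x : EuclideanSpace ℝ (Fin d)) = D.flow x (D.tstar x).toNNReal := by
  rw [exit, dif_pos ⟨h, D.flow_tstar_mem x h⟩]

/-! ### The jump rate along a trajectory -/

/-- The jump rate `λ(φ(x,s), ℓ(x,a,s))` along the trajectory from `x`. -/
noncomputable def rate (x : D.E) (a : U) (s : ℝ≥0) : ℝ≥0 := D.lam (D.flowE x s, D.ell (x, a, s))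

lemma Lam_eq_cum (x : D.E) (a : U) : D.Lam x a = cum (D.rate x a) := rfl

lemma measurable_along : Measurable fun p : (D.E × U) × ℝ≥0 =>
    (D.flowE p.1.1 p.2, D.ell (p.1.1, p.1.2, p.2)) := by
  have h1 : Measurable fun q : (D.E × U) × ℝ≥0 => D.flowE q.1.1 q.2 :=
    D.measurable_flowE.comp (by fun_prop : Measurable fun q : (D.E × U) × ℝ≥0 => (q.1.1, q.2))
  exact h1.prodMk (D.measurable_ell.comp (by fun_prop))

lemma measurable_rate_uncurry : Measurable fun p : (D.E × U) × ℝ≥0 => D.rate p.1.1 p.1.2 p.2 :=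
  D.measurable_lam.comp D.measurable_along

lemma measurable_rate (x : D.E) (a : U) : Measurable (D.rate x a) :=
  D.measurable_rate_uncurry.comp (by fun_prop : Measurable fun s : ℝ≥0 => ((x, a), s))

variable {D} in
lemma RateBounds.Lam_lt_top (h : RateBounds D) (x : D.E) (a : U) {t : ℝ≥0}
    (ht : (t : ℝ≥0∞) < D.tstar x) : D.Lam x a t < ⊤ := by
  obtain ⟨lamUp, -, -, -, -, hle, hfin, -⟩ := h
  refine lt_of_le_of_lt ?_ (hfin x t ht)
  rw [Lam_eq_cum, cum_coe]
  exact lintegral_mono fun s => ENNReal.coe_le_coe.mpr (hle _ _)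

/-- The domain of integration varies with the parameter; as an indicator under the fixed measure
`leb` it becomes part of a jointly measurable integrand. `measurable_L` and `measurable_runCost` use
the same device. -/
lemma measurable_Lam_uncurry : Measurable fun p : (D.E × U) × ℝ≥0∞ => D.Lam p.1.1 p.1.2 p.2 := by
  have : (fun p : (D.E × U) × ℝ≥0∞ => D.Lam p.1.1 p.1.2 p.2) = fun p =>
      ∫⁻ s, {q : ((D.E × U) × ℝ≥0∞) × ℝ≥0 | (q.2 : ℝ≥0∞) < q.1.2}.indicator
        (fun q => (D.rate q.1.1.1 q.1.1.2 q.2 : ℝ≥0∞)) (p, s) ∂leb := by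
    ext p
    rw [Lam, ← lintegral_indicator (measurableSet_coe_lt _)]
    rfl
  rw [this]
  refine Measurable.lintegral_prod_right' ?_
  refine Measurable.indicator ?_ (measurableSet_lt (by fun_prop) (by fun_prop))
  exact (D.measurable_rate_uncurry.comp
    (by fun_prop : Measurable fun q : ((D.E × U) × ℝ≥0∞) × ℝ≥0 => (q.1.1, q.2))).coe_nnreal_ennreal

lemma measurable_wt (α : ℝ≥0) :
    Measurable fun p : (D.E × U) × ℝ≥0∞ => wt D α p.1.1 p.1.2 p.2 := by
  unfold wt
  have := D.measurable_Lam_uncurry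
  fun_prop

variable {D}

lemma measurable_L (α : ℝ≥0) {h : D.E × U → ℝ≥0∞} (hh : Measurable h) : Measurable (L α h) := by
  have : L α h = fun p : D.E × (U × U) =>
      ∫⁻ s, {q : (D.E × (U × U)) × ℝ≥0 | (q.2 : ℝ≥0∞) < D.tstar q.1.1}.indicator
        (fun q => wt D α q.1.1 q.1.2.1 q.2 * h (D.flowE q.1.1 q.2, q.1.2.1)) (p, s) ∂leb := by
    ext p
    rw [L, ← lintegral_indicator (measurableSet_coe_lt _)]
    rfl
  rw [this]
  refine Measurable.lintegral_prod_right' ?_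
  have h1 : Measurable fun q : (D.E × (U × U)) × ℝ≥0 => wt D α q.1.1 q.1.2.1 q.2 :=
    (D.measurable_wt α).comp (by fun_prop :
      Measurable fun q : (D.E × (U × U)) × ℝ≥0 => ((q.1.1, q.1.2.1), (q.2 : ℝ≥0∞)))
  have h2 : Measurable fun q : (D.E × (U × U)) × ℝ≥0 => D.flowE q.1.1 q.2 :=
    D.measurable_flowE.comp (by fun_prop :
      Measurable fun q : (D.E × (U × U)) × ℝ≥0 => (q.1.1, q.2))
  refine Measurable.indicator (h1.mul (hh.comp (h2.prodMk (by fun_prop)))) ?_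
  exact measurableSet_lt (by fun_prop) (D.measurable_tstar.comp (by fun_prop))

lemma measurable_H (α : ℝ≥0) {g : frontier D.E × U → ℝ≥0∞} (hg : Measurable g) :
    Measurable (H α g : D.E × (U × U) → ℝ≥0∞) := by
  have h1 : Measurable fun p : D.E × (U × U) => wt D α p.1 p.2.1 (D.tstar p.1) :=
    (D.measurable_wt α).comp ((by fun_prop : Measurable fun p : D.E × (U × U) => (p.1, p.2.1)).prodMk
      (D.measurable_tstar.comp measurable_fst))
  exact h1.mul (hg.comp ((D.measurable_exit.comp measurable_fst).prodMk (by fun_prop)))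

lemma measurable_stage {m : ℕ} (C : PDMPCosts D m) (α : ℝ≥0) (i : Fin (m + 1)) :
    Measurable (stage C α i) :=
  (measurable_L α (C.measurable_f i).coe_nnreal_ennreal).add
    (measurable_H α (C.measurable_r i).coe_nnreal_ennreal)

/-! ### The law of the interjump time -/

lemma jumpTime_le_tstar (x : D.E) (a : U) (ξ : ℝ) : D.jumpTime x a ξ ≤ D.tstar x :=
  iSup₂_le fun _ h => h.1.le

/-- One direction is monotonicity of `Λ`. The other is its right-continuity at `t`: if the level `ξ`
is not reached at `t`, it is not reached at some slightly later time either. -/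
lemma lt_jumpTime_iff (hrate : RateBounds D) (x : D.E) (a : U) (ξ : ℝ) {t : ℝ≥0}
    (ht : (t : ℝ≥0∞) < D.tstar x) :
    (t : ℝ≥0∞) < D.jumpTime x a ξ ↔ D.Lam x a t < ENNReal.ofReal ξ := by
  simp only [jumpTime, lt_iSup_iff, exists_prop]
  constructor
  · rintro ⟨s, ⟨-, h2⟩, h3⟩
    exact (D.Lam_mono x a h3.le).trans_lt h2
  · intro h
    -- Finiteness of the cumulated rate at an intermediate `T` gives continuity of the primitive on
    -- `[0, T]`, hence to the right of `t`.
    obtain ⟨T, htT, hT⟩ := ENNReal.lt_iff_exists_nnreal_btwn.mp ht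
    have htT' : (t : ℝ) < T := by exact_mod_cast htT
    have hTfin := hrate.Lam_lt_top x a hT
    rw [Lam_eq_cum] at h hTfin
    have hi := intervalIntegrable_of_cum (D.measurable_rate x a) hTfin
    rw [intervalIntegrable_iff_integrableOn_Icc_of_le T.coe_nonneg, ← uIcc_of_le T.coe_nonneg] at hi
    have hc := (intervalIntegral.continuousOn_primitive_interval hi) t
      (by rw [uIcc_of_le T.coe_nonneg]; exact ⟨t.coe_nonneg, htT'.le⟩)
    have hc' : Tendsto (fun s : ℝ => ENNReal.ofReal (∫ r in (0 : ℝ)..s, (D.rate x a r.toNNReal : ℝ)))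
        (𝓝[Ioo (t : ℝ) T] t) (𝓝 (cum (D.rate x a) t)) := by
      have e := cum_eq_ofReal (D.measurable_rate x a) hTfin (t := t) ⟨t.coe_nonneg, htT'.le⟩
      rw [Real.toNNReal_coe] at e
      rw [e]
      refine (ENNReal.continuous_ofReal.tendsto _).comp (hc.mono_left (nhdsWithin_mono _ ?_))
      rw [uIcc_of_le T.coe_nonneg]
      exact fun s hs => ⟨t.coe_nonneg.trans hs.1.le, hs.2.le⟩
    have hne : (𝓝[Ioo (t : ℝ) T] (t : ℝ)).NeBot := by
      rw [nhdsWithin_Ioo_eq_nhdsGT htT']; infer_instance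
    obtain ⟨s, hs1, hs2⟩ := ((hc'.eventually (gt_mem_nhds h)).and self_mem_nhdsWithin).exists
    have hs0 : 0 ≤ s := t.coe_nonneg.trans hs2.1.le
    have hsT : (s.toNNReal : ℝ≥0∞) < T := by
      rw [ENNReal.coe_lt_coe, Real.toNNReal_lt_iff_lt_coe hs0]; exact hs2.2
    refine ⟨s.toNNReal, ⟨hsT.trans hT, ?_⟩, ?_⟩
    · rw [Lam_eq_cum, cum_eq_ofReal (D.measurable_rate x a) hTfin ⟨hs0, hs2.2.le⟩]
      exact hs1
    · rw [ENNReal.coe_lt_coe, Real.lt_toNNReal_iff_coe_lt]; exact hs2.1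

lemma expMeasure_lt_ofReal {y : ℝ≥0∞} (hy : y < ⊤) :
    expMeasure 1 {ξ : ℝ | y < ENNReal.ofReal ξ} = expNeg y := by
  lift y to ℝ≥0 using hy.ne
  have : IsProbabilityMeasure (expMeasure 1) := isProbabilityMeasure_expMeasure one_pos
  have h1 : {ξ : ℝ | (y : ℝ≥0∞) < ENNReal.ofReal ξ} = (Iic (y : ℝ))ᶜ := by
    ext ξ
    rw [mem_ofPred_eq, ENNReal.ofReal, ENNReal.coe_lt_coe, Real.lt_toNNReal_iff_coe_lt]
    simp
  have h2 := cdf_expMeasure_eq one_pos (y : ℝ)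
  rw [cdf_eq_real, if_pos y.coe_nonneg] at h2
  rw [h1, prob_compl_eq_one_sub measurableSet_Iic, ← ofReal_measureReal, h2]
  have hexp : Real.exp (-(1 * (y : ℝ))) ≤ 1 := Real.exp_le_one_iff.mpr (by simp)
  rw [← ENNReal.ofReal_one, ← ENNReal.ofReal_sub _ (by linarith)]
  simp [expNeg]

lemma sojourn_apply (x : D.E) (a : U) {A : Set ℝ≥0∞} (hA : MeasurableSet A) :
    D.sojourn (x, a) A = expMeasure 1 {ξ | D.jumpTime x a ξ ∈ A} := by
  have : IsProbabilityMeasure (expMeasure 1) := isProbabilityMeasure_expMeasure one_pos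
  rw [sojourn, Kernel.map_apply' _ D.measurable_jumpTime _ hA, Kernel.prod_apply, Kernel.id_apply,
    Kernel.const_apply, Measure.dirac_prod, Measure.map_apply (by fun_prop)
      (D.measurable_jumpTime hA)]
  rfl

lemma sojourn_Ioi (hrate : RateBounds D) (x : D.E) (a : U) {t : ℝ≥0}
    (ht : (t : ℝ≥0∞) < D.tstar x) : D.sojourn (x, a) (Ioi (t : ℝ≥0∞)) = expNeg (D.Lam x a t) := by
  rw [sojourn_apply x a measurableSet_Ioi]
  simp only [mem_Ioi, lt_jumpTime_iff hrate x a _ ht]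
  exact expMeasure_lt_ofReal (hrate.Lam_lt_top x a ht)

lemma sojourn_le_tstar (x : D.E) (a : U) : ∀ᵐ s ∂D.sojourn (x, a), s ≤ D.tstar x := by
  rw [ae_iff]
  change D.sojourn (x, a) {s | s ≤ D.tstar x}ᶜ = 0
  rw [sojourn_apply x a (measurableSet_le measurable_id measurable_const :
    MeasurableSet {s | s ≤ D.tstar x}).compl]
  have : {ξ : ℝ | D.jumpTime x a ξ ∈ {s | s ≤ D.tstar x}ᶜ} = ∅ := by
    ext ξ
    simp [jumpTime_le_tstar]
  rw [this, measure_empty]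

/-- Compare distribution functions. Below `t_*` both sides are one minus the survival function
`e^{-Λ}`; from `t_*` on both are `1`, since the atom carries exactly the mass that the density
leaves. -/
lemma sojourn_eq (hrate : RateBounds D) (x : D.E) (a : U) :
    D.sojourn (x, a) =
      ((leb.restrict {s : ℝ≥0 | (s : ℝ≥0∞) < D.tstar x}).withDensity
        fun s => expNeg (D.Lam x a s) * D.rate x a s).map (fun s : ℝ≥0 => (s : ℝ≥0∞)) +
      expNeg (D.Lam x a (D.tstar x)) • Measure.dirac (D.tstar x) := by
  have hm := measurable_cum (D.rate x a)
  have hr := D.measurable_rate x a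
  have huniv := setLIntegral_expNeg_cum_add hr (D.tstar_pos x)
    fun t ht => hrate.Lam_lt_top x a ht
  rw [Lam_eq_cum] at *
  have hmeas : Measurable fun s : ℝ≥0 => expNeg (cum (D.rate x a) s) * D.rate x a s := by fun_prop
  have hval : ∀ A : Set ℝ≥0∞, MeasurableSet A →
      (((leb.restrict {s : ℝ≥0 | (s : ℝ≥0∞) < D.tstar x}).withDensity
        fun s => expNeg (cum (D.rate x a) s) * D.rate x a s).map (fun s : ℝ≥0 => (s : ℝ≥0∞)) +
      expNeg (cum (D.rate x a) (D.tstar x)) • Measure.dirac (D.tstar x)) A =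
      ∫⁻ s in {s : ℝ≥0 | (s : ℝ≥0∞) ∈ A} ∩ {s : ℝ≥0 | (s : ℝ≥0∞) < D.tstar x},
        expNeg (cum (D.rate x a) s) * D.rate x a s ∂leb +
      expNeg (cum (D.rate x a) (D.tstar x)) * A.indicator 1 (D.tstar x) := by
    intro A hA
    rw [Measure.add_apply, Measure.map_apply measurable_coe_nnreal_ennreal hA,
      withDensity_apply _ (measurable_coe_nnreal_ennreal hA),
      Measure.restrict_restrict (measurable_coe_nnreal_ennreal hA), Measure.smul_apply,
      Measure.dirac_apply' _ hA]
    rfl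
  refine Measure.ext_of_Iic _ _ fun t => ?_
  rw [hval _ measurableSet_Iic]
  rcases lt_or_ge t (D.tstar x) with ht | ht
  · lift t to ℝ≥0 using (ht.trans_le le_top).ne
    have h1 : D.sojourn (x, a) (Iic (t : ℝ≥0∞)) = 1 - expNeg (cum (D.rate x a) t) := by
      rw [← compl_Ioi, prob_compl_eq_one_sub measurableSet_Ioi, sojourn_Ioi hrate x a ht,
        Lam_eq_cum]
    have h2 := lintegral_expNeg_cum_add hr (hrate.Lam_lt_top x a ht)
    have h3 : {s : ℝ≥0 | (s : ℝ≥0∞) ∈ Iic (t : ℝ≥0∞)} ∩ {s : ℝ≥0 | (s : ℝ≥0∞) < D.tstar x} =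
        {s | s ≤ t} := by
      ext s
      simp only [mem_Iic, ENNReal.coe_le_coe, mem_inter_iff, mem_ofPred_eq, and_iff_left_iff_imp]
      exact fun h => lt_of_le_of_lt (by exact_mod_cast h) ht
    rw [h1, h3, indicator_of_notMem (by simpa using ht), mul_zero, add_zero]
    exact (ENNReal.eq_sub_of_add_eq
      (ne_top_of_le_ne_top ENNReal.one_ne_top (expNeg_le_one _)) h2).symm
  · have h3 : {s : ℝ≥0 | (s : ℝ≥0∞) ∈ Iic t} ∩ {s : ℝ≥0 | (s : ℝ≥0∞) < D.tstar x} =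
        {s : ℝ≥0 | (s : ℝ≥0∞) < D.tstar x} := by
      ext s
      simp only [mem_Iic, mem_inter_iff, mem_ofPred_eq, and_iff_right_iff_imp]
      exact fun h => h.le.trans ht
    rw [h3, indicator_of_mem (by simpa using ht), Pi.one_apply, mul_one, huniv]
    rw [← mem_ae_iff_prob_eq_one measurableSet_Iic]
    filter_upwards [sojourn_le_tstar x a] with s hs using hs.trans ht

lemma lintegral_sojourn (hrate : RateBounds D) (x : D.E) (a : U) {g : ℝ≥0∞ → ℝ≥0∞}
    (hg : Measurable g) :
    ∫⁻ s, g s ∂D.sojourn (x, a) =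
      ∫⁻ s in {s : ℝ≥0 | (s : ℝ≥0∞) < D.tstar x},
        expNeg (D.Lam x a s) * D.rate x a s * g s ∂leb +
      expNeg (D.Lam x a (D.tstar x)) * g (D.tstar x) := by
  have hm := measurable_cum (D.rate x a)
  have hr := D.measurable_rate x a
  rw [← Lam_eq_cum] at hm
  rw [sojourn_eq hrate, lintegral_add_measure, lintegral_map hg measurable_coe_nnreal_ennreal,
    lintegral_withDensity_eq_lintegral_mul _ (by fun_prop) (by fun_prop), lintegral_smul_measure,
    lintegral_dirac' _ hg]
  rfl

/-- The absolutely continuous part has no atoms and the only atom sits at `t_* > 0`. Positivity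
makes finite jump times strictly increasing, so that `N(t-)` at a jump time counts exactly the
earlier jumps. -/
lemma sojourn_pos (hrate : RateBounds D) (x : D.E) (a : U) : ∀ᵐ s ∂D.sojourn (x, a), 0 < s := by
  have h0 : D.sojourn (x, a) {0} = 0 := by
    rw [← lintegral_indicator_one (measurableSet_singleton 0),
      lintegral_sojourn hrate x a (measurable_one.indicator (measurableSet_singleton 0)),
      indicator_of_notMem (by simpa using (D.tstar_pos x).ne'), mul_zero, add_zero]
    refine (lintegral_congr_ae ?_).trans lintegral_zero
    refine ae_restrict_of_ae ?_
    filter_upwards [compl_mem_ae_iff.mpr (measure_singleton (μ := leb) 0)] with s hs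
    rw [indicator_of_notMem (by simpa using hs), mul_zero]
  filter_upwards [compl_mem_ae_iff.mpr h0] with s hs using pos_iff_ne_zero.mpr hs

end PDMP

namespace PDMP

variable {d : ℕ} {U V : Type*} [MeasurableSpace U] [MeasurableSpace V] (D : PDMP d U V)

/-! ### The kernel `G` and the potential inequality -/

/-- The joint law of the interjump time and of the next post-jump location. -/
noncomputable def jump : Kernel (D.E × (U × U)) (ℝ≥0∞ × D.E) :=
  D.sojourn.comap (fun p : D.E × (U × U) => (p.1, p.2.1)) (by fun_prop) ⊗ₖ D.postJump

instance : IsMarkovKernel D.jump := by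
  unfold jump; infer_instance

/-- `G` as a kernel: the law of the next post-jump location, discounted by the interjump time. -/
noncomputable def Gker (α : ℝ≥0) : Kernel (D.E × (U × U)) D.E :=
  (Kernel.withDensity D.jump fun _ r => expNeg (α * r.1)).snd

instance (α : ℝ≥0) : IsFiniteKernel (D.Gker α) := by
  have : IsFiniteKernel (Kernel.withDensity D.jump fun _ r => expNeg (α * r.1)) :=
    Kernel.isFiniteKernel_withDensity_of_bounded _ ENNReal.one_ne_top fun _ _ => expNeg_le_one _
  unfold Gker; infer_instance

variable {D}

lemma lintegral_Gker_eq_lintegral_jump (α : ℝ≥0) (p : D.E × (U × U)) {h : D.E → ℝ≥0∞}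
    (hh : Measurable h) :
    ∫⁻ y, h y ∂D.Gker α p = ∫⁻ r, expNeg (α * r.1) * h r.2 ∂D.jump p := by
  rw [Gker, Kernel.lintegral_snd _ _ hh, Kernel.lintegral_withDensity _ (by fun_prop) _ (by fun_prop)]

/-- The density of the interjump time gives the integral term. The atom at `t_*` gives the boundary
term, as the strict inequality in `postJump` sends `s = t_*` to `Qb`. -/
lemma lintegral_Gker (hrate : RateBounds D) (α : ℝ≥0) (p : D.E × (U × U)) {h : D.E → ℝ≥0∞}
    (hh : Measurable h) :
    ∫⁻ y, h y ∂D.Gker α p =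
      ∫⁻ s in {s : ℝ≥0 | (s : ℝ≥0∞) < D.tstar p.1},
        wt D α p.1 p.2.1 s * D.lam (D.flowE p.1 s, D.ell (p.1, p.2.1, s)) *
          ∫⁻ y, h y ∂D.Q (D.flowE p.1 s, D.ell (p.1, p.2.1, s)) ∂leb +
      wt D α p.1 p.2.1 (D.tstar p.1) * ∫⁻ y, h y ∂D.Qb (D.exit p.1, p.2.2) := by
  rw [lintegral_Gker_eq_lintegral_jump α p hh, jump, Kernel.lintegral_compProd _ _ _ (by fun_prop),
    Kernel.comap_apply]
  have h1 : ∀ s, ∫⁻ y, expNeg (α * s) * h y ∂D.postJump (p, s) =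
      expNeg (α * s) * ∫⁻ y, h y ∂D.postJump (p, s) := fun s => lintegral_const_mul _ hh
  simp only [h1]
  rw [lintegral_sojourn hrate]
  · congr 1
    · refine setLIntegral_congr_fun (measurableSet_coe_lt _) fun s hs => ?_
      simp only [wt, expNeg_add, postJump, Kernel.piecewise_apply, mem_ofPred_eq] at hs ⊢
      rw [if_pos hs, Kernel.comap_apply, ENNReal.toNNReal_coe]
      simp only [rate]
      ring
    · simp only [wt, expNeg_add, postJump, Kernel.piecewise_apply, mem_ofPred_eq, lt_irrefl,
        if_false, Kernel.comap_apply]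
      ring
  · have : Measurable fun q : ℝ≥0∞ => ∫⁻ y, h y ∂D.postJump (p, q) :=
      (hh.lintegral_kernel (κ := D.postJump)).comp (by fun_prop)
    fun_prop

lemma Gker_apply (hrate : RateBounds D) (α : ℝ≥0) (p : D.E × (U × U)) {B : Set D.E}
    (hB : MeasurableSet B) : D.Gker α p B = G α p B := by
  rw [← lintegral_indicator_one hB, lintegral_Gker hrate α p (measurable_one.indicator hB)]
  simp only [lintegral_indicator_one hB, G]

lemma cum_const_add (ρ : ℝ≥0 → ℝ≥0) (α t : ℝ≥0) :
    cum (fun s => α + ρ s) t = α * t + cum ρ t := by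
  rw [cum_coe, cum_coe]
  simp only [ENNReal.coe_add]
  rw [lintegral_add_left measurable_const, setLIntegral_leb_Iic measurable_const]
  simp

/-- If `𝒳v - (α + λ) v ≤ -λ (β + Qv)` along the flow and `β + Qv ≤ v` at the boundary, then `G`
integrates `β + v` to at most `v`. -/
lemma lintegral_Gker_le (hrate : RateBounds D) {α : ℝ≥0} (hα : 0 < α) {β : ℝ} (hβ : 0 ≤ β)
    {v Xv : D.E → ℝ} (hv : Measurable v) (hv0 : ∀ x, 0 ≤ v x) (hX : IsFlowDerivative v Xv)
    (x : D.E) (a : U × U)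
    (hint : ∀ t : ℝ≥0, (t : ℝ≥0∞) < D.tstar x →
      Integrable v (D.Q (D.flowE x t, D.ell (x, a.1, t))) ∧
      Xv (D.flowE x t) - (α + D.rate x a.1 t) * v (D.flowE x t) ≤
        -(D.rate x a.1 t * (β + ∫ y, v y ∂(D.Q (D.flowE x t, D.ell (x, a.1, t))))))
    (hlim : D.tstar x < ⊤ → ∃ l : ℝ, IsBoundaryValue v x l)
    (hbd : D.tstar x < ⊤ → Integrable v (D.Qb (D.exit x, a.2)) ∧
      ∀ l : ℝ, IsBoundaryValue v x l → β + ∫ y, v y ∂(D.Qb (D.exit x, a.2)) ≤ l) :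
    ∫⁻ y, (ENNReal.ofReal β + ENNReal.ofReal (v y)) ∂D.Gker α (x, a) ≤ ENNReal.ofReal (v x) := by
  have hvm : Measurable fun y => ENNReal.ofReal (v y) := by fun_prop
  have hmass : ∀ (μ : Measure D.E) [IsProbabilityMeasure μ],
      Integrable v μ → ∫⁻ y, (ENNReal.ofReal β + ENNReal.ofReal (v y)) ∂μ =
        ENNReal.ofReal (β + ∫ y, v y ∂μ) := by
    intro μ _ hi
    rw [lintegral_add_left measurable_const, lintegral_const, measure_univ, mul_one,
      ENNReal.ofReal_add hβ (integral_nonneg hv0),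
      ofReal_integral_eq_lintegral_ofReal hi (ae_of_all _ hv0)]
  -- Discounting at the rate `α` amounts to adding `α` to the jump rate.
  set ρ : ℝ≥0 → ℝ≥0 := fun s => α + D.rate x a.1 s with hρdef
  have hρ : Measurable ρ := measurable_const.add (D.measurable_rate x a.1)
  have hwt : ∀ s : ℝ≥0, wt D α x a.1 s = expNeg (cum ρ s) := fun s => by
    rw [cum_const_add, wt, Lam_eq_cum]
  have hcum : ∀ T : ℝ≥0, (T : ℝ≥0∞) < D.tstar x → cum ρ T < ⊤ := fun T hT => by
    rw [cum_const_add]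
    exact ENNReal.add_lt_top.mpr
      ⟨ENNReal.mul_lt_top ENNReal.coe_lt_top ENNReal.coe_lt_top, hrate.Lam_lt_top x a.1 hT⟩
  set I : ℝ≥0 → ℝ≥0∞ := fun s =>
    ∫⁻ y, (ENNReal.ofReal β + ENNReal.ofReal (v y)) ∂D.Q (D.flowE x s, D.ell (x, a.1, s)) with hI
  have hIm : Measurable I := by
    have : Measurable fun s : ℝ≥0 => (D.flowE x s, D.ell (x, a.1, s)) :=
      D.measurable_along.comp (by fun_prop : Measurable fun s : ℝ≥0 => ((x, a.1), s))
    exact (Measurable.lintegral_kernel (κ := D.Q) (by fun_prop)).comp this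
  -- `toNNReal` loses nothing where it matters: `v` is integrable for `Q` before the exit time, so
  -- `I s` is finite there.
  set q : ℝ≥0 → ℝ≥0 := fun s => D.rate x a.1 s * (I s).toNNReal with hq
  have hqm : Measurable q := (D.measurable_rate x a.1).mul hIm.ennreal_toNNReal
  have hflow : Measurable fun s : ℝ≥0 => D.flowE x s :=
    D.measurable_flowE.comp (by fun_prop : Measurable fun s : ℝ≥0 => (x, s))
  have hIeq : ∀ s : ℝ≥0, (s : ℝ≥0∞) < D.tstar x → I s =
      ENNReal.ofReal (β + ∫ y, v y ∂(D.Q (D.flowE x s, D.ell (x, a.1, s)))) := fun s hs =>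
    hmass _ (hint s hs).1
  have hcore : ∀ T : ℝ≥0, (T : ℝ≥0∞) < D.tstar x →
      wt D α x a.1 T * ENNReal.ofReal (v (D.flowE x T)) +
        ∫⁻ s in {s : ℝ≥0 | (s : ℝ≥0∞) < T}, expNeg (cum ρ s) * q s ∂leb ≤ ENNReal.ofReal (v x) := by
    intro T hT
    have := expNeg_cum_mul_add_lintegral_le hρ hqm (hcum T hT) (v := fun s => v (D.flowE x s))
      (u := fun s => Xv (D.flowE x s)) (hX.1.comp hflow) (hX.2 x T hT).1 (fun t ht => by
        have ht' : (t : ℝ≥0∞) < D.tstar x := lt_of_le_of_lt (by exact_mod_cast ht) hT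
        rw [D.flowE_zero]
        exact (hX.2 x t ht').2) (hv0 _) (fun t ht => by
        have ht' : (t : ℝ≥0∞) < D.tstar x := lt_of_le_of_lt (by exact_mod_cast ht) hT
        have h0 : 0 ≤ ∫ y, v y ∂(D.Q (D.flowE x t, D.ell (x, a.1, t))) := integral_nonneg hv0
        have := (hint t ht').2
        simp only [hρdef, hq, hIeq t ht', NNReal.coe_mul, NNReal.coe_add,
          ENNReal.coe_toNNReal_eq_toReal, ENNReal.toReal_ofReal (add_nonneg hβ h0)]
        exact this)
    rw [D.flowE_zero] at this
    rwa [hwt]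
  obtain ⟨t, ht, htlim, hL⟩ := exists_seq_tendsto_setLIntegral (D.tstar_pos x)
  have hwtlim : Tendsto (fun n => wt D α x a.1 (t n)) atTop (𝓝 (wt D α x a.1 (D.tstar x))) := by
    refine (continuous_expNeg.tendsto _).comp (Tendsto.add ?_ ?_)
    · exact ENNReal.Tendsto.const_mul htlim (Or.inr ENNReal.coe_ne_top)
    · exact hL fun s => (D.rate x a.1 s : ℝ≥0∞)
  have hQint := hL fun s => expNeg (cum ρ s) * q s
  rw [lintegral_Gker hrate α (x, a) (by fun_prop)]
  have hfirst : ∫⁻ s in {s : ℝ≥0 | (s : ℝ≥0∞) < D.tstar x},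
      wt D α x a.1 s * D.lam (D.flowE x s, D.ell (x, a.1, s)) * I s ∂leb =
      ∫⁻ s in {s : ℝ≥0 | (s : ℝ≥0∞) < D.tstar x}, expNeg (cum ρ s) * q s ∂leb := by
    refine setLIntegral_congr_fun (measurableSet_coe_lt _) fun s hs => ?_
    simp only [hq, hwt, ENNReal.coe_mul]
    rw [ENNReal.coe_toNNReal (by rw [hIeq s hs]; exact ENNReal.ofReal_ne_top), mul_assoc]
    rfl
  refine le_trans (add_le_add hfirst.le le_rfl) ?_
  -- If the boundary is never reached, `α > 0` kills the boundary term. Otherwise `v` tends along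
  -- the flow to its boundary value, which dominates `β + ∫ v dQb`.
  rcases eq_or_ne (D.tstar x) ⊤ with htop | htop
  · have : wt D α x a.1 (D.tstar x) = 0 := by
      rw [htop, wt, ENNReal.mul_top (by exact_mod_cast hα.ne'), top_add, expNeg_top]
    simp only [this, zero_mul, add_zero]
    exact le_of_tendsto' hQint fun n => le_add_self.trans (hcore _ (ht n).2)
  · have hlt := lt_top_iff_ne_top.mpr htop
    obtain ⟨l, hl⟩ := hlim hlt
    have ht' : Tendsto t atTop (𝓝[<] (D.tstar x).toNNReal) := by
      refine tendsto_nhdsWithin_iff.mpr ⟨?_, Eventually.of_forall fun n => ?_⟩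
      · have := (ENNReal.tendsto_toNNReal htop).comp htlim
        simpa [Function.comp_def] using this
      · rw [mem_Iio, ← ENNReal.coe_lt_coe, ENNReal.coe_toNNReal htop]
        exact (ht n).2
    have hvl : Tendsto (fun n => ENNReal.ofReal (v (D.flowE x (t n)))) atTop (𝓝 (ENNReal.ofReal l)) :=
      (ENNReal.continuous_ofReal.tendsto _).comp (hl.comp ht')
    have hwtne : wt D α x a.1 (D.tstar x) ≠ ⊤ :=
      ne_top_of_le_ne_top ENNReal.one_ne_top (expNeg_le_one _)
    have hfin := le_of_tendsto' ((ENNReal.Tendsto.mul hwtlim (Or.inr ENNReal.ofReal_ne_top) hvl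
      (Or.inr hwtne)).add hQint) fun n => hcore _ (ht n).2
    refine le_trans ?_ hfin
    rw [add_comm]
    gcongr
    rw [hmass _ (hbd hlt).1]
    exact ENNReal.ofReal_le_ofReal ((hbd hlt).2 l hl)

/-- The expected growth condition gives a potential `v ≤ M w₀` with `∫ (β + v) dG ≤ v` on `𝒦`. -/
lemma Growth.exists_potential {m : ℕ} {C : PDMPCosts D m} {α c₀ : ℝ≥0} (hα : 0 < α)
    (hrate : RateBounds D) (h : Growth C α c₀) :
    ∃ (β : ℝ≥0∞) (M : ℝ≥0) (v : D.E → ℝ≥0∞), 0 < β ∧ Measurable v ∧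
      (∀ x, v x ≤ M * w₀ C α c₀ x) ∧ ∀ p ∈ D.K, ∫⁻ y, (β + v y) ∂D.Gker α p ≤ v p.1 := by
  obtain ⟨-, b, c, v, Xv, -, hc, ⟨hvm, -, hlim⟩, hv0, ⟨M, hM⟩, hX, hmain⟩ := h
  refine ⟨ENNReal.ofReal (c + α), M, fun x => ENNReal.ofReal (v x), by
    simp only [ENNReal.ofReal_pos]; linarith, by fun_prop, hM, ?_⟩
  rintro ⟨x, a⟩ ha
  obtain ⟨-, -, hin, hbd⟩ := hmain x a ha
  have hcα : 0 < c + α := by linarith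
  refine lintegral_Gker_le hrate hα hcα.le hvm hv0 hX x a (fun t ht => ?_) (hlim x) (fun hlt => ?_)
  · obtain ⟨h1, h2, h3⟩ := hin t ht
    refine ⟨h1, ?_⟩
    -- Inserting this bound for `b` into the first growth inequality cancels the `c v` terms and
    -- leaves `𝒳v - (α + λ) v ≤ -λ (c + α + ∫ v dQ)`.
    have h4 : b (D.flowE x t) ≤ (c + α) *
        (v (D.flowE x t) - D.lam (D.flowE x t, D.ell (x, a.1, t))) := by
      have := mul_le_mul_of_nonneg_left h3 hcα.le
      rw [mul_add, ← mul_assoc, mul_one_div_cancel hcα.ne'] at this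
      linarith
    simp only [rate]
    nlinarith
  · obtain ⟨h1, h2⟩ := hbd hlt
    exact ⟨h1, fun l hl => by linarith [h2 l hl]⟩

end PDMP

namespace PDMP

variable {d : ℕ} {U V : Type*} [MeasurableSpace U] [MeasurableSpace V] {D : PDMP d U V}

/-! ### The chain of post-jump locations and actions -/

@[fun_prop]
lemma measurable_T (k : ℕ) : Measurable (T (D := D) k) := by
  unfold T; fun_prop

@[fun_prop]
lemma measurable_Z (k : ℕ) : Measurable (Z (D := D) k) := by
  unfold Z; fun_prop

@[fun_prop]
lemma measurable_Θ (k : ℕ) : Measurable (Θ (D := D) k) := by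
  unfold Θ; fun_prop

lemma T_succ (k : ℕ) (ω : ℕ → D.Rec) : T (k + 1) ω = T k ω + (ω (k + 1)).1.1 := by
  rw [T, Finset.sum_range_succ]; rfl

lemma lintegral_step (η : D.Selector) (p : D.E × (U × U)) {Ψ : D.Rec → ℝ≥0∞} (hΨ : Measurable Ψ) :
    ∫⁻ r, Ψ r ∂D.step η p = ∫⁻ q, ∫⁻ a, Ψ (q, a) ∂η.ker q.2 ∂D.jump p := by
  change ∫⁻ r, Ψ r ∂(D.jump ⊗ₖ η.ker.comap (fun p : (D.E × (U × U)) × (ℝ≥0∞ × D.E) => p.2.2)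
    (by fun_prop)) p = _
  rw [Kernel.lintegral_compProd _ _ _ hΨ]
  rfl

lemma lintegral_step_time (η : D.Selector) (p : D.E × (U × U)) {g : ℝ≥0∞ → ℝ≥0∞}
    (hg : Measurable g) : ∫⁻ r, g r.1.1 ∂D.step η p = ∫⁻ s, g s ∂D.sojourn (p.1, p.2.1) := by
  rw [lintegral_step η p (by fun_prop)]
  simp only [lintegral_const, measure_univ, mul_one]
  rw [jump, Kernel.lintegral_compProd _ _ _ (by fun_prop)]
  simp only [lintegral_const, measure_univ, mul_one]
  rfl

section Prob

variable (ν₀ : Measure D.E) (u : D.Strategy)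

/-- The discounted law of the `k`-th post-jump location and actions. -/
noncomputable def disc (α : ℝ≥0) (k : ℕ) : Measure (D.E × (U × U)) :=
  ((D.prob ν₀ u).withDensity fun ω => expNeg (α * T k ω)).map fun ω => (Z k ω, Θ k ω)

lemma occ_eq_sum_disc (α : ℝ≥0) : occ α ν₀ u = Measure.sum (disc ν₀ u α) := rfl

lemma lintegral_disc (α : ℝ≥0) (k : ℕ) {h : D.E × (U × U) → ℝ≥0∞} (hh : Measurable h) :
    ∫⁻ p, h p ∂disc ν₀ u α k = ∫⁻ ω, expNeg (α * T k ω) * h (Z k ω, Θ k ω) ∂D.prob ν₀ u := by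
  rw [disc, lintegral_map hh (by fun_prop),
    lintegral_withDensity_eq_lintegral_mul _ (by fun_prop) (by fun_prop)]
  rfl

lemma map_prob_zero : (D.prob ν₀ u).map (fun ω => (Z 0 ω, Θ 0 ω)) = ν₀ ⊗ₘ (u 0).ker := by
  have h1 : (D.prob ν₀ u).map (Preorder.frestrictLe 0) =
      ((ν₀ ⊗ₘ (u 0).ker).map fun p : D.E × (U × U) => (((0 : ℝ≥0∞), p.1), p.2)).map
        (MeasurableEquiv.piUnique fun _ : Finset.Iic 0 => D.Rec).symm := by
    rw [prob, Kernel.trajMeasure, Measure.map_comp _ _ (by fun_prop),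
      Kernel.traj_map_frestrictLe, Kernel.partialTraj_self, Measure.id_comp]
  have h2 : (fun ω : ℕ → D.Rec => (Z 0 ω, Θ 0 ω)) =
      (fun h : (i : Finset.Iic 0) → D.Rec => ((h ⟨0, by simp⟩).1.2, (h ⟨0, by simp⟩).2)) ∘
        Preorder.frestrictLe (π := fun _ => D.Rec) 0 := rfl
  rw [h2, ← Measure.map_map (by fun_prop) (by fun_prop), h1,
    Measure.map_map (by fun_prop) (by fun_prop), Measure.map_map (by fun_prop) (by fun_prop)]
  exact Measure.map_id

lemma disc_zero (α : ℝ≥0) : disc ν₀ u α 0 = ν₀ ⊗ₘ (u 0).ker := by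
  rw [disc, ← map_prob_zero]
  simp [T]

variable [IsProbabilityMeasure ν₀]

instance : IsProbabilityMeasure
    ((ν₀ ⊗ₘ (u 0).ker).map fun p : D.E × (U × U) => (((0 : ℝ≥0∞), p.1), p.2)) :=
  Measure.isProbabilityMeasure_map (by fun_prop)

instance : IsProbabilityMeasure (D.prob ν₀ u) := by
  unfold prob; infer_instance

lemma lintegral_prob_frestrictLe (k : ℕ) {F : ((i : Finset.Iic k) → D.Rec) × D.Rec → ℝ≥0∞}
    (hF : Measurable F) :
    ∫⁻ ω, F (Preorder.frestrictLe (π := fun _ => D.Rec) k ω, ω (k + 1)) ∂D.prob ν₀ u =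
      ∫⁻ ω, ∫⁻ r, F (Preorder.frestrictLe (π := fun _ => D.Rec) k ω, r)
        ∂D.step (u (k + 1)) (Z k ω, Θ k ω) ∂D.prob ν₀ u := by
  have h := Kernel.map_frestrictLe_trajMeasure_compProd_eq_map_trajMeasure (X := fun _ : ℕ => D.Rec)
    (μ₀ := (ν₀ ⊗ₘ (u 0).ker).map fun p : D.E × (U × U) => (((0 : ℝ≥0∞), p.1), p.2))
    (κ := D.trans u) (a := k)
  have h1 := congrArg (fun μ => ∫⁻ q, F q ∂μ) h
  rw [lintegral_map hF (by fun_prop), Measure.lintegral_compProd hF,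
    lintegral_map hF.lintegral_kernel_prod_right' (by fun_prop)] at h1
  exact h1.symm

/-- The Markov property: the next record is drawn by `step` given the present jump time,
location and actions. -/
lemma lintegral_prob_succ (k : ℕ) {Ψ : (ℝ≥0∞ × (D.E × (U × U))) × D.Rec → ℝ≥0∞}
    (hΨ : Measurable Ψ) :
    ∫⁻ ω, Ψ ((T k ω, (Z k ω, Θ k ω)), ω (k + 1)) ∂D.prob ν₀ u =
      ∫⁻ ω, ∫⁻ r, Ψ ((T k ω, (Z k ω, Θ k ω)), r)
        ∂D.step (u (k + 1)) (Z k ω, Θ k ω) ∂D.prob ν₀ u := by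
  classical
  -- Extends a finite history to a whole sequence. The filler beyond `k` is irrelevant, because `T
  -- k`, `Z k` and `Θ k` only read the indices up to `k`.
  let e : ((i : Finset.Iic k) → D.Rec) → ℕ → D.Rec := fun h i =>
    if hi : i ∈ Finset.Iic k then h ⟨i, hi⟩ else h ⟨k, Finset.mem_Iic.mpr le_rfl⟩
  have he : Measurable e := by
    refine measurable_pi_iff.mpr fun i => ?_
    by_cases hi : i ∈ Finset.Iic k
    · simp only [e, hi, dite_true]; fun_prop
    · simp only [e, hi, dite_false]; fun_prop
  have heq : ∀ ω : ℕ → D.Rec, ∀ i ≤ k, e (Preorder.frestrictLe (π := fun _ => D.Rec) k ω) i = ω i := by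
    intro ω i hi
    simp only [e, Finset.mem_Iic.mpr hi, dite_true]
    rfl
  have hT : ∀ ω : ℕ → D.Rec, T k (e (Preorder.frestrictLe (π := fun _ => D.Rec) k ω)) = T k ω := by
    intro ω
    refine Finset.sum_congr rfl fun i hi => ?_
    rw [heq ω (i + 1) (by have := Finset.mem_range.mp hi; omega)]
  have hZ : ∀ ω : ℕ → D.Rec, Z k (e (Preorder.frestrictLe (π := fun _ => D.Rec) k ω)) = Z k ω :=
    fun ω => by rw [Z, heq ω k le_rfl, Z]
  have hΘ : ∀ ω : ℕ → D.Rec, Θ k (e (Preorder.frestrictLe (π := fun _ => D.Rec) k ω)) = Θ k ω :=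
    fun ω => by rw [Θ, heq ω k le_rfl, Θ]
  have := lintegral_prob_frestrictLe ν₀ u k
    (F := fun q => Ψ ((T k (e q.1), (Z k (e q.1), Θ k (e q.1))), q.2)) (by fun_prop)
  simpa only [hT, hZ, hΘ] using this

/-- These are the only almost sure facts needed by the pathwise cost identities; the Markov property
reduces them to the interjump law. -/
lemma ae_sojourn (hrate : RateBounds D) :
    ∀ᵐ ω ∂D.prob ν₀ u, ∀ k, 0 < (ω (k + 1)).1.1 ∧ (ω (k + 1)).1.1 ≤ D.tstar (Z k ω) := by
  rw [ae_all_iff]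
  intro k
  have hts := D.measurable_tstar
  set A : Set (D.E × ℝ≥0∞) := {q | ¬ (0 < q.2 ∧ q.2 ≤ D.tstar q.1)} with hA
  have hAm : MeasurableSet A :=
    ((measurableSet_lt measurable_const measurable_snd).inter
      (measurableSet_le measurable_snd (hts.comp measurable_fst))).compl
  have h := lintegral_prob_succ ν₀ u k (Ψ := fun q => A.indicator 1 (q.1.2.1, q.2.1.1))
    ((measurable_one.indicator hAm).comp (by fun_prop))
  have h0 : ∀ p : D.E × (U × U), ∫⁻ r, A.indicator 1 (p.1, r.1.1) ∂D.step (u (k + 1)) p = 0 := by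
    intro p
    rw [lintegral_step_time _ p (g := fun s => A.indicator 1 (p.1, s))
      ((measurable_one.indicator hAm).comp (by fun_prop))]
    refine (lintegral_congr_ae ?_).trans lintegral_zero
    filter_upwards [sojourn_pos hrate p.1 p.2.1, sojourn_le_tstar p.1 p.2.1] with s h1 h2
    exact indicator_of_notMem (fun h : ¬ _ => h ⟨h1, h2⟩) _
  simp only [h0, lintegral_zero] at h
  have hm : Measurable fun ω : ℕ → D.Rec =>
      A.indicator (1 : D.E × ℝ≥0∞ → ℝ≥0∞) (Z k ω, (ω (k + 1)).1.1) :=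
    (measurable_one.indicator hAm).comp (by fun_prop)
  rw [lintegral_eq_zero_iff hm] at h
  filter_upwards [h] with ω hω
  by_contra hn
  rw [indicator_of_mem (show (Z k ω, (ω (k + 1)).1.1) ∈ A from hn)] at hω
  simp at hω

instance (α : ℝ≥0) (k : ℕ) : IsFiniteMeasure (disc ν₀ u α k) := by
  refine ⟨?_⟩
  rw [← lintegral_one, lintegral_disc ν₀ u α k measurable_const]
  refine lt_of_le_of_lt (lintegral_mono (g := fun _ => 1) fun ω => ?_) (by simp)
  simpa using expNeg_le_one _

/-- The discount factors as `e^{-αT_{k+1}} = e^{-αT_k} e^{-αS}`. By the Markov property the second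
factor, averaged with the next location, is `G`, and the next actions depend only on that location.
-/
lemma disc_succ (α : ℝ≥0) (k : ℕ) :
    disc ν₀ u α (k + 1) = (D.Gker α ∘ₘ disc ν₀ u α k) ⊗ₘ (u (k + 1)).ker := by
  refine Measure.ext_of_lintegral _ fun h hh => ?_
  have hη : Measurable fun y => ∫⁻ a, h (y, a) ∂(u (k + 1)).ker y :=
    hh.lintegral_kernel_prod_right'
  have hη' : Measurable fun r : ℝ≥0∞ × D.E =>
      expNeg (α * r.1) * ∫⁻ a, h (r.2, a) ∂(u (k + 1)).ker r.2 :=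
    Measurable.mul (by fun_prop) (hη.comp measurable_snd)
  rw [lintegral_disc ν₀ u α _ hh, Measure.lintegral_compProd hh,
    Measure.lintegral_bind (Kernel.aemeasurable _) hη.aemeasurable,
    lintegral_disc ν₀ u α k (Measurable.lintegral_kernel (by fun_prop))]
  have := lintegral_prob_succ ν₀ u k
    (Ψ := fun q => expNeg (α * (q.1.1 + q.2.1.1)) * h (q.2.1.2, q.2.2)) (by fun_prop)
  simp only [T_succ]
  refine this.trans (lintegral_congr fun ω => ?_)
  rw [lintegral_step _ _ (by fun_prop), lintegral_Gker_eq_lintegral_jump α _ hη,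
    ← lintegral_const_mul _ hη']
  refine lintegral_congr fun q => ?_
  simp only [mul_add, expNeg_add]
  rw [lintegral_const_mul _ (by fun_prop), mul_assoc]

end Prob

end PDMP

namespace PDMP

variable {d : ℕ} {U V : Type*} [MeasurableSpace U] [MeasurableSpace V] {D : PDMP d U V}

/-! ### The cost as an integral over the occupation measure -/

lemma setLIntegral_leb_Ici {f : ℝ≥0 → ℝ≥0∞} (hf : Measurable f) (t : ℝ≥0) :
    ∫⁻ s in Ici t, f s ∂leb = ∫⁻ s, f (t + s) ∂leb := by
  have h1 : Real.toNNReal ⁻¹' Ici t ∩ Ici 0 = Ici (t : ℝ) := by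
    ext s
    simp only [mem_inter_iff, mem_preimage, mem_Ici]
    constructor
    · rintro ⟨h, h0⟩
      exact (Real.le_toNNReal_iff_coe_le h0).mp h
    · intro h
      have h0 := t.coe_nonneg.trans h
      exact ⟨(Real.le_toNNReal_iff_coe_le h0).mpr h, h0⟩
  rw [setLIntegral_leb hf measurableSet_Ici, h1, ← setLIntegral_univ (μ := leb),
    setLIntegral_leb (f := fun s => f (t + s)) (by fun_prop) MeasurableSet.univ, preimage_univ,
    univ_inter, ← lintegral_indicator measurableSet_Ici, ← lintegral_indicator measurableSet_Ici,
    ← lintegral_add_left_eq_self _ (t : ℝ)]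
  refine lintegral_congr fun s => ?_
  by_cases hs : 0 ≤ s
  · rw [indicator_of_mem (by simpa using hs), indicator_of_mem (by simpa using hs),
      Real.toNNReal_add t.coe_nonneg hs, Real.toNNReal_coe]
  · rw [indicator_of_notMem (by simpa using hs), indicator_of_notMem (by simpa using hs)]

lemma setLIntegral_leb_Ico {f : ℝ≥0 → ℝ≥0∞} (hf : Measurable f) (t : ℝ≥0) (r : ℝ≥0∞) :
    ∫⁻ s in {s : ℝ≥0 | t ≤ s ∧ (s : ℝ≥0∞) < t + r}, f s ∂leb =
      ∫⁻ s in {s : ℝ≥0 | (s : ℝ≥0∞) < r}, f (t + s) ∂leb := by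
  have h1 : {s : ℝ≥0 | t ≤ s ∧ (s : ℝ≥0∞) < t + r} =
      {s : ℝ≥0 | (s : ℝ≥0∞) < t + r} ∩ Ici t := by
    ext s; simp [and_comm]
  rw [h1, ← Measure.restrict_restrict (measurableSet_coe_lt _),
    ← lintegral_indicator (measurableSet_coe_lt _),
    setLIntegral_leb_Ici (hf.indicator (measurableSet_coe_lt _)),
    ← lintegral_indicator (measurableSet_coe_lt _)]
  refine lintegral_congr fun s => ?_
  have : t + s ∈ {s : ℝ≥0 | (s : ℝ≥0∞) < t + r} ↔ s ∈ {s : ℝ≥0 | (s : ℝ≥0∞) < r} := by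
    simp only [mem_ofPred_eq, ENNReal.coe_add]
    exact ENNReal.add_lt_add_iff_left ENNReal.coe_ne_top
  by_cases hs : s ∈ {s : ℝ≥0 | (s : ℝ≥0∞) < r}
  · rw [indicator_of_mem hs, indicator_of_mem (this.mpr hs)]
  · rw [indicator_of_notMem hs, indicator_of_notMem (mt this.mp hs)]

lemma T_mono (ω : ℕ → D.Rec) : Monotone fun k => T k ω :=
  monotone_nat_of_le_succ fun k => by rw [T_succ]; exact le_self_add

lemma N_eq {ω : ℕ → D.Rec} {k : ℕ} {s : ℝ≥0} (h1 : T k ω ≤ s) (h2 : s < T (k + 1) ω) :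
    N s ω = k := by
  have : {i : ℕ | 1 ≤ i ∧ T i ω ≤ s} = ↑(Finset.Icc 1 k) := by
    ext i
    simp only [mem_ofPred_eq, Finset.coe_Icc, mem_Icc, and_congr_right_iff]
    refine fun _ => ⟨fun h => ?_, fun h => (T_mono ω h).trans h1⟩
    by_contra hn
    exact absurd (h2.trans_le ((T_mono ω (by omega : k + 1 ≤ i)).trans h)) (lt_irrefl _)
  rw [N, this, ncard_coe_finset, Nat.card_Icc, Nat.add_sub_cancel]

lemma Nminus_eq {ω : ℕ → D.Rec} {k : ℕ} {s : ℝ≥0} (h1 : T k ω < s) (h2 : s ≤ T (k + 1) ω) :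
    Nminus s ω = k := by
  have : {i : ℕ | 1 ≤ i ∧ T i ω < s} = ↑(Finset.Icc 1 k) := by
    ext i
    simp only [mem_ofPred_eq, Finset.coe_Icc, mem_Icc, and_congr_right_iff]
    refine fun _ => ⟨fun h => ?_, fun h => (T_mono ω h).trans_lt h1⟩
    by_contra hn
    exact absurd ((h.trans_le h2).trans_le (T_mono ω (by omega : k + 1 ≤ i))) (lt_irrefl _)
  rw [Nminus, this, ncard_coe_finset, Nat.card_Icc, Nat.add_sub_cancel]

/-! ### Expected costs of a single stage -/

section Stage

variable {m : ℕ} (C : PDMPCosts D m) (α : ℝ≥0) (i : Fin (m + 1))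

/-- The running cost of one stage, when the stage lasts `r`. -/
noncomputable def runCost (p : D.E × (U × U)) (r : ℝ≥0∞) : ℝ≥0∞ :=
  ∫⁻ s in {s : ℝ≥0 | (s : ℝ≥0∞) < r}, expNeg (α * s) * C.f i (D.flowE p.1 s, p.2.1) ∂leb

open Classical in
/-- The boundary cost of one stage, when the stage lasts `r`. -/
noncomputable def boundaryCost (p : D.E × (U × U)) (r : ℝ≥0∞) : ℝ≥0∞ :=
  expNeg (α * r) * if r = D.tstar p.1 then (C.r i (D.exit p.1, p.2.2) : ℝ≥0∞) else 0

lemma measurable_runCost :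
    Measurable fun q : (D.E × (U × U)) × ℝ≥0∞ => runCost C α i q.1 q.2 := by
  have : (fun q : (D.E × (U × U)) × ℝ≥0∞ => runCost C α i q.1 q.2) = fun q =>
      ∫⁻ s, {z : ((D.E × (U × U)) × ℝ≥0∞) × ℝ≥0 | (z.2 : ℝ≥0∞) < z.1.2}.indicator
        (fun z => expNeg (α * z.2) * C.f i (D.flowE z.1.1.1 z.2, z.1.1.2.1)) (q, s) ∂leb := by
    ext q
    rw [runCost, ← lintegral_indicator (measurableSet_coe_lt _)]
    rfl
  rw [this]
  refine Measurable.lintegral_prod_right' ?_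
  refine Measurable.indicator ?_ (measurableSet_lt (by fun_prop) (by fun_prop))
  have h2 : Measurable fun z : ((D.E × (U × U)) × ℝ≥0∞) × ℝ≥0 => D.flowE z.1.1.1 z.2 :=
    D.measurable_flowE.comp (by fun_prop :
      Measurable fun z : ((D.E × (U × U)) × ℝ≥0∞) × ℝ≥0 => (z.1.1.1, z.2))
  exact Measurable.mul (by fun_prop)
    ((C.measurable_f i).comp (h2.prodMk (by fun_prop))).coe_nnreal_ennreal

lemma measurable_boundaryCost :
    Measurable fun q : (D.E × (U × U)) × ℝ≥0∞ => boundaryCost C α i q.1 q.2 := by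
  have hts := D.measurable_tstar
  refine Measurable.mul (by fun_prop) (Measurable.ite ?_ ?_ measurable_const)
  · exact measurableSet_eq_fun (by fun_prop) (hts.comp (by fun_prop))
  · exact ((C.measurable_r i).comp
      ((D.measurable_exit.comp (by fun_prop)).prodMk (by fun_prop))).coe_nnreal_ennreal

variable {C α i}

/-- Tonelli: the cost rate at time `s` is charged exactly when the stage outlasts `s`, which has
probability `e^{-Λ(s)}` for `s < t_*` and `0` afterwards. -/
lemma lintegral_runCost (hrate : RateBounds D) (p : D.E × (U × U)) :
    ∫⁻ r, runCost C α i p r ∂D.sojourn (p.1, p.2.1) = L α (fun q => (C.f i q : ℝ≥0∞)) p := by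
  set g : ℝ≥0 → ℝ≥0∞ := fun s => expNeg (α * s) * C.f i (D.flowE p.1 s, p.2.1) with hg
  have hgm : Measurable g := by
    have h2 : Measurable fun s : ℝ≥0 => D.flowE p.1 s :=
      D.measurable_flowE.comp (by fun_prop : Measurable fun s : ℝ≥0 => (p.1, s))
    exact Measurable.mul (by fun_prop)
      ((C.measurable_f i).comp (h2.prodMk (by fun_prop))).coe_nnreal_ennreal
  have h1 : ∀ r, runCost C α i p r =
      ∫⁻ s, {z : ℝ≥0∞ × ℝ≥0 | (z.2 : ℝ≥0∞) < z.1}.indicator (fun z => g z.2) (r, s) ∂leb := by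
    intro r
    rw [runCost, ← lintegral_indicator (measurableSet_coe_lt _)]
    rfl
  have hm : Measurable fun z : ℝ≥0∞ × ℝ≥0 =>
      {z : ℝ≥0∞ × ℝ≥0 | (z.2 : ℝ≥0∞) < z.1}.indicator (fun z => g z.2) z :=
    (hgm.comp measurable_snd).indicator (measurableSet_lt (by fun_prop) (by fun_prop))
  simp only [h1]
  rw [lintegral_lintegral_swap hm.aemeasurable, L, ← lintegral_indicator (measurableSet_coe_lt _)]
  refine lintegral_congr fun s => ?_
  have h2 : ∀ r : ℝ≥0∞, {z : ℝ≥0∞ × ℝ≥0 | (z.2 : ℝ≥0∞) < z.1}.indicator (fun z => g z.2) (r, s) =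
      (Ioi (s : ℝ≥0∞)).indicator (fun _ => g s) r := fun r => rfl
  simp only [h2]
  rw [lintegral_indicator_const measurableSet_Ioi]
  by_cases hs : (s : ℝ≥0∞) < D.tstar p.1
  · rw [indicator_of_mem (by exact hs), sojourn_Ioi hrate _ _ hs, wt, expNeg_add, hg]
    ring
  · rw [indicator_of_notMem (by exact hs)]
    have : D.sojourn (p.1, p.2.1) (Ioi (s : ℝ≥0∞)) = 0 := by
      refine measure_mono_null (fun r hr => ?_) (ae_iff.mp (sojourn_le_tstar p.1 p.2.1))
      exact not_le.mpr (lt_of_le_of_lt (not_lt.mp hs) hr)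
    rw [this, mul_zero]

/-- Only the atom of the interjump law at `t_*` contributes. -/
lemma lintegral_boundaryCost (hrate : RateBounds D) (p : D.E × (U × U)) :
    ∫⁻ r, boundaryCost C α i p r ∂D.sojourn (p.1, p.2.1) = H α (fun q => (C.r i q : ℝ≥0∞)) p := by
  have hm : Measurable (boundaryCost C α i p) :=
    (measurable_boundaryCost C α i).comp (by fun_prop : Measurable fun r : ℝ≥0∞ => (p, r))
  rw [lintegral_sojourn hrate _ _ hm]
  have h0 : ∫⁻ s in {s : ℝ≥0 | (s : ℝ≥0∞) < D.tstar p.1},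
      expNeg (D.Lam p.1 p.2.1 s) * D.rate p.1 p.2.1 s * boundaryCost C α i p s ∂leb = 0 := by
    refine (setLIntegral_congr_fun (g := fun _ => 0) (measurableSet_coe_lt _) fun s hs => ?_).trans
      lintegral_zero
    have : (s : ℝ≥0∞) ≠ D.tstar p.1 := ne_of_lt hs
    simp [boundaryCost, this]
  rw [h0, zero_add, boundaryCost, if_pos rfl, H, wt, expNeg_add]
  ring

end Stage

/-! ### Costs along a trajectory as sums over stages -/

section Pathwise

variable {m : ℕ} (C : PDMPCosts D m) {α : ℝ≥0} (i : Fin (m + 1))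

/-- The intervals `[T_k, T_{k+1})` partition `[0, T_∞)`. On each of them `N` equals `k` and the path
follows the flow inside `E`; a shift by `T_k` pulls out the discount. -/
lemma lintegral_running_eq_tsum (hα : 0 < α) {ω : ℕ → D.Rec}
    (hω : ∀ k, 0 < (ω (k + 1)).1.1 ∧ (ω (k + 1)).1.1 ≤ D.tstar (Z k ω)) :
    ∫⁻ s in {s : ℝ≥0 | (s : ℝ≥0∞) < Tinf ω},
      expNeg (α * s) * ext (C.f i) (X s ω) (Θ (N s ω) ω).1 ∂leb =
    ∑' k, expNeg (α * T k ω) * runCost C α i (Z k ω, Θ k ω) (ω (k + 1)).1.1 := by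
  have hU : {s : ℝ≥0 | (s : ℝ≥0∞) < Tinf ω} =
      ⋃ k, (fun s : ℝ≥0 => (s : ℝ≥0∞)) ⁻¹' Ico (T k ω) (T (k + 1) ω) := by
    ext s
    simp only [mem_ofPred_eq, Tinf, lt_iSup_iff, mem_iUnion, mem_preimage, mem_Ico]
    constructor
    · intro h
      classical
      have hne : Nat.find h ≠ 0 := by
        intro h0
        have := Nat.find_spec h
        rw [h0] at this
        simp [T] at this
      refine ⟨Nat.find h - 1, not_lt.mp (Nat.find_min h (by omega)), ?_⟩
      rw [Nat.sub_add_cancel (Nat.one_le_iff_ne_zero.mpr hne)]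
      exact Nat.find_spec h
    · rintro ⟨k, -, h⟩
      exact ⟨k + 1, h⟩
  have hdisj : Pairwise (Function.onFun Disjoint
      fun k => (fun s : ℝ≥0 => (s : ℝ≥0∞)) ⁻¹' Ico (T k ω) (T (k + 1) ω)) := fun k l hkl =>
    Disjoint.preimage _ ((T_mono ω).pairwise_disjoint_on_Ico_succ hkl)
  rw [hU, lintegral_iUnion (fun k => measurable_coe_nnreal_ennreal measurableSet_Ico) hdisj]
  refine tsum_congr fun k => ?_
  -- When `T_k = ∞` the interval is empty and the discount vanishes, so both sides are `0`.
  rcases eq_or_ne (T k ω) ⊤ with hT | hT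
  · have h1 : (fun s : ℝ≥0 => (s : ℝ≥0∞)) ⁻¹' Ico (T k ω) (T (k + 1) ω) = ∅ := by
      ext s; simp [hT]
    rw [h1, hT, ENNReal.mul_top (by exact_mod_cast hα.ne')]
    simp
  · obtain ⟨t, ht⟩ : ∃ t : ℝ≥0, (t : ℝ≥0∞) = T k ω := ⟨_, ENNReal.coe_toNNReal hT⟩
    set r := (ω (k + 1)).1.1 with hr
    have h1 : (fun s : ℝ≥0 => (s : ℝ≥0∞)) ⁻¹' Ico (T k ω) (T (k + 1) ω) =
        {s : ℝ≥0 | t ≤ s ∧ (s : ℝ≥0∞) < t + r} := by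
      ext s; simp [T_succ, ← ht, hr]
    have h2 : Measurable fun s : ℝ≥0 => D.flowE (Z k ω) (s - t) :=
      D.measurable_flowE.comp (by fun_prop : Measurable fun s : ℝ≥0 => (Z k ω, s - t))
    have h3 : Measurable fun s : ℝ≥0 =>
        expNeg (α * s) * C.f i (D.flowE (Z k ω) (s - t), (Θ k ω).1) :=
      Measurable.mul (by fun_prop)
        ((C.measurable_f i).comp (h2.prodMk measurable_const)).coe_nnreal_ennreal
    have h4 : ∀ s ∈ {s : ℝ≥0 | t ≤ s ∧ (s : ℝ≥0∞) < t + r},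
        expNeg (α * s) * ext (C.f i) (X s ω) (Θ (N s ω) ω).1 =
          expNeg (α * s) * C.f i (D.flowE (Z k ω) (s - t), (Θ k ω).1) := by
      intro s hs
      have hsub : ((s - t : ℝ≥0) : ℝ≥0∞) < D.tstar (Z k ω) := by
        refine lt_of_lt_of_le ?_ (hω k).2
        rw [← hr, ← ENNReal.add_lt_add_iff_left (ENNReal.coe_ne_top (r := t)), ← ENNReal.coe_add,
          add_tsub_cancel_of_le hs.1]
        exact hs.2
      have hN : N s ω = k := N_eq (by rw [← ht]; exact_mod_cast hs.1)
        (by rw [T_succ, ← ht]; exact hs.2)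
      have hX : X s ω = D.flow (Z k ω) (s - t) := by
        rw [X, hN, ← ht, ← ENNReal.coe_sub, ENNReal.toNNReal_coe]
      rw [hN, ext, dif_pos (by rw [hX]; exact D.flow_mem _ hsub)]
      congr 4
      exact Subtype.ext (by rw [D.coe_flowE _ hsub]; exact hX)
    rw [h1, setLIntegral_congr_fun (h1 ▸ measurable_coe_nnreal_ennreal measurableSet_Ico) h4,
      setLIntegral_leb_Ico h3, runCost, ← lintegral_const_mul]
    · refine lintegral_congr fun s => ?_
      rw [add_tsub_cancel_left, ENNReal.coe_add, mul_add, expNeg_add, ht, mul_assoc]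
    · have h5 : Measurable fun s : ℝ≥0 => D.flowE (Z k ω) s :=
        D.measurable_flowE.comp (by fun_prop : Measurable fun s : ℝ≥0 => (Z k ω, s))
      exact Measurable.mul (by fun_prop)
        ((C.measurable_f i).comp (h5.prodMk measurable_const)).coe_nnreal_ennreal

/-- `p*` is a sum of Dirac masses at jump times, and a jump comes from the boundary exactly when the
stage lasts until `t_*`. -/
lemma lintegral_pstar_eq_tsum (hα : 0 < α) {ω : ℕ → D.Rec}
    (hω : ∀ k, 0 < (ω (k + 1)).1.1 ∧ (ω (k + 1)).1.1 ≤ D.tstar (Z k ω)) :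
    ∫⁻ s in {s : ℝ≥0 | 0 < s ∧ (s : ℝ≥0∞) ≤ Tinf ω},
      expNeg (α * s) * ext (C.r i) (Xminus s ω) (Θ (Nminus s ω) ω).2 ∂(pstar ω) =
    ∑' k, expNeg (α * T k ω) * boundaryCost C α i (Z k ω, Θ k ω) (ω (k + 1)).1.1 := by
  classical
  have hA : MeasurableSet {s : ℝ≥0 | 0 < s ∧ (s : ℝ≥0∞) ≤ Tinf ω} :=
    (measurableSet_lt measurable_const measurable_id).inter
      (measurableSet_le measurable_coe_nnreal_ennreal measurable_const)
  rw [pstar, Measure.restrict_sum _ hA, lintegral_sum_measure]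
  refine tsum_congr fun k => ?_
  set r := (ω (k + 1)).1.1 with hr
  have hTs : T (k + 1) ω = T k ω + r := T_succ k ω
  rcases eq_or_ne (T (k + 1) ω) ⊤ with hT | hT
  · have h0 : expNeg (α * T k ω) * expNeg (α * r) = 0 := by
      rw [← expNeg_add, ← mul_add, ← hTs, hT, ENNReal.mul_top (by exact_mod_cast hα.ne'),
        expNeg_top]
    rw [boundaryCost, ← mul_assoc, h0, if_neg (by simp [hT])]
    simp
  · have hTk : T k ω ≠ ⊤ := ne_top_of_le_ne_top hT (T_mono ω (Nat.le_succ k))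
    have hrtop : r ≠ ⊤ := ne_top_of_le_ne_top hT (hTs ▸ le_add_self)
    set s := (T (k + 1) ω).toNNReal with hs
    have hsc : (s : ℝ≥0∞) = T (k + 1) ω := ENNReal.coe_toNNReal hT
    have hlt : T k ω < T (k + 1) ω := by
      rw [hTs]
      exact ENNReal.lt_add_right hTk (hω k).1.ne'
    have hN : Nminus s ω = k := Nminus_eq (hsc ▸ hlt) hsc.le
    have hX : Xminus s ω = D.flow (Z k ω) r.toNNReal := by
      rw [Xminus, hN, hsc, hTs, ENNReal.add_sub_cancel_left hTk]
    have hsA : s ∈ {s : ℝ≥0 | 0 < s ∧ (s : ℝ≥0∞) ≤ Tinf ω} := by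
      refine ⟨?_, ?_⟩
      · rw [← ENNReal.coe_pos, hsc]
        exact pos_of_gt hlt
      · rw [hsc]; exact le_iSup (fun k => T k ω) (k + 1)
    -- Before `t_*` the flow stays in the open set `E`, which is disjoint from its frontier; at a
    -- finite `t_*` it is on the frontier.
    have hfr : Xminus s ω ∈ frontier D.E ↔ r = D.tstar (Z k ω) := by
      rw [hX]
      constructor
      · intro h
        by_contra hne
        have hmem := D.flow_mem (Z k ω) (t := r.toNNReal)
          (by rw [ENNReal.coe_toNNReal hrtop]; exact lt_of_le_of_ne (hω k).2 hne)
        rw [D.isOpen_E.frontier_eq] at h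
        exact h.2 hmem
      · intro h
        rw [h]
        exact D.flow_tstar_mem _ (h ▸ hrtop)
    rw [boundaryCost]
    by_cases hb : r = D.tstar (Z k ω)
    · rw [if_pos ⟨lt_top_iff_ne_top.mpr hT, hfr.mpr hb⟩, if_pos hb, setLIntegral_dirac, if_pos hsA,
        hN, ext, dif_pos (hfr.mpr hb), hsc, hTs, mul_add, expNeg_add, mul_assoc]
      congr 5
      exact Subtype.ext (hX.trans (by rw [D.coe_exit _ (hb ▸ hrtop), hb]))
    · rw [if_neg (fun h => hb (hfr.mp h.2)), if_neg hb]
      simp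

end Pathwise

/-- The cost of a strategy is the integral of the one-stage cost over its occupation measure. -/
lemma cost_eq_lintegral_occ {m : ℕ} (C : PDMPCosts D m) {α : ℝ≥0} (hα : 0 < α)
    (hrate : RateBounds D) (ν₀ : Measure D.E) [IsProbabilityMeasure ν₀] (i : Fin (m + 1))
    (u : D.Strategy) : cost C α ν₀ i u = ∫⁻ p, stage C α i p ∂occ α ν₀ u := by
  have hrun := measurable_runCost C α i
  have hbd := measurable_boundaryCost C α i
  have h1 : cost C α ν₀ i u = ∫⁻ ω, ∑' k, expNeg (α * T k ω) *
      (runCost C α i (Z k ω, Θ k ω) (ω (k + 1)).1.1 +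
        boundaryCost C α i (Z k ω, Θ k ω) (ω (k + 1)).1.1) ∂D.prob ν₀ u := by
    refine lintegral_congr_ae ?_
    filter_upwards [ae_sojourn ν₀ u hrate] with ω hω
    rw [J, lintegral_running_eq_tsum C i hα hω, lintegral_pstar_eq_tsum C i hα hω,
      ← ENNReal.tsum_add]
    simp only [mul_add]
  have hm : Measurable fun q : (D.E × (U × U)) × ℝ≥0∞ =>
      runCost C α i q.1 q.2 + boundaryCost C α i q.1 q.2 := hrun.add hbd
  rw [h1, occ_eq_sum_disc, lintegral_sum_measure, lintegral_tsum]
  · refine tsum_congr fun k => ?_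
    rw [lintegral_disc ν₀ u α k (measurable_stage C α i)]
    have h2 := lintegral_prob_succ ν₀ u k (Ψ := fun q => expNeg (α * q.1.1) *
      (runCost C α i q.1.2 q.2.1.1 + boundaryCost C α i q.1.2 q.2.1.1))
      (Measurable.mul (by fun_prop) (hm.comp (by fun_prop :
        Measurable fun q : (ℝ≥0∞ × (D.E × (U × U))) × D.Rec => (q.1.2, q.2.1.1))))
    refine h2.trans (lintegral_congr fun ω => ?_)
    simp only
    have h3 : ∀ p : D.E × (U × U), Measurable fun r : ℝ≥0∞ =>
        runCost C α i p r + boundaryCost C α i p r := fun p =>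
      hm.comp (by fun_prop : Measurable fun r : ℝ≥0∞ => (p, r))
    have h4 : Measurable fun r : D.Rec =>
        runCost C α i (Z k ω, Θ k ω) r.1.1 + boundaryCost C α i (Z k ω, Θ k ω) r.1.1 :=
      (h3 (Z k ω, Θ k ω)).comp (by fun_prop : Measurable fun r : D.Rec => r.1.1)
    have h5 : Measurable (runCost C α i (Z k ω, Θ k ω)) :=
      hrun.comp (by fun_prop : Measurable fun r : ℝ≥0∞ => ((Z k ω, Θ k ω), r))
    rw [lintegral_const_mul _ h4,
      lintegral_step_time _ _ (h3 _), lintegral_add_left h5,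
      lintegral_runCost hrate, lintegral_boundaryCost hrate, stage]
  · intro k
    exact (Measurable.mul (by fun_prop) (hm.comp (by fun_prop :
      Measurable fun ω : ℕ → D.Rec => ((Z k ω, Θ k ω), (ω (k + 1)).1.1)))).aemeasurable

end PDMP

namespace PDMP

variable {d : ℕ} {U V : Type*} [MeasurableSpace U] [MeasurableSpace V] {D : PDMP d U V}

/-! ### Measures carried by `𝒦` and selectors -/

lemma measurableSet_S (hK : MeasurableSet D.K) (x : D.E) : MeasurableSet (D.S x) :=
  (measurable_prodMk_left (x := x)) hK

lemma Selector.ker_compl_S (hK : MeasurableSet D.K) (φ : D.Selector) (x : D.E) :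
    φ.ker x (D.S x)ᶜ = 0 :=
  (prob_compl_eq_zero_iff (measurableSet_S hK x)).mpr (φ.ker_S x)

lemma compProd_compl_K (hK : MeasurableSet D.K) (ν : Measure D.E) [SFinite ν] (φ : D.Selector) :
    (ν ⊗ₘ φ.ker) D.Kᶜ = 0 := by
  rw [Measure.compProd_apply hK.compl]
  exact (lintegral_congr fun x => φ.ker_compl_S hK x).trans lintegral_zero

lemma restrict_K {μ : Measure (D.E × (U × U))} (h : μ D.Kᶜ = 0) : μ.restrict D.K = μ :=
  Measure.restrict_eq_self_of_ae_mem (mem_ae_iff.mpr h)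

/-- The conditional kernel of `μ` charges `𝕊(x)` fully only for almost every `x`; on the exceptional
set it is replaced by `φ₀`, since a selector must be feasible at every point. -/
lemma exists_selector_compProd [StandardBorelSpace U] (hK : MeasurableSet D.K) (φ₀ : D.Selector)
    [Nonempty D.E] (μ : Measure (D.E × (U × U))) [IsFiniteMeasure μ] (hμ : μ D.Kᶜ = 0) :
    ∃ φ : D.Selector, μ.fst ⊗ₘ φ.ker = μ := by
  classical
  have : Nonempty (U × U) := (φ₀.ker (Classical.arbitrary D.E)).nonempty_of_neZero
  have hdis : μ.fst ⊗ₘ μ.condKernel = μ := μ.disintegrate μ.condKernel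
  have hA : MeasurableSet {x : D.E | μ.condKernel x (D.S x) = 1} :=
    (Kernel.measurable_kernel_prodMk_left hK) (measurableSet_singleton 1)
  have hae : ∀ᵐ x ∂μ.fst, μ.condKernel x (D.S x) = 1 := by
    rw [← hdis, Measure.compProd_apply hK.compl,
      lintegral_eq_zero_iff (Kernel.measurable_kernel_prodMk_left hK.compl)] at hμ
    filter_upwards [hμ] with x hx
    exact (prob_compl_eq_zero_iff (measurableSet_S hK x)).mp hx
  refine ⟨⟨Kernel.piecewise hA μ.condKernel φ₀.ker, inferInstance, fun x => ?_⟩, ?_⟩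
  · rw [Kernel.piecewise_apply]
    split_ifs with hx
    · exact hx
    · exact φ₀.ker_S x
  · conv_rhs => rw [← hdis]
    refine Measure.compProd_congr ?_
    filter_upwards [hae] with x hx
    rw [Kernel.piecewise_apply, if_pos (show x ∈ {x : D.E | μ.condKernel x (D.S x) = 1} from hx)]

lemma lintegral_compProd_eq_avg (hK : MeasurableSet D.K) (ν : Measure D.E) [SFinite ν]
    (φ : D.Selector) {h : D.E × (U × U) → ℝ≥0∞} (hh : Measurable h) :
    ∫⁻ p, h p ∂(ν ⊗ₘ φ.ker) = ∫⁻ x, avg h φ x ∂ν := by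
  rw [Measure.lintegral_compProd hh]
  refine lintegral_congr fun x => ?_
  have hS : ∀ᵐ a ∂φ.ker x, a ∈ D.S x := mem_ae_iff.mpr (φ.ker_compl_S hK x)
  rw [avg, Measure.restrict_eq_self_of_ae_mem hS]

/-! ### Consequences of the potential inequality -/

lemma mul_comp_Gker_add_lintegral_le {α : ℝ≥0} {β : ℝ≥0∞} {v : D.E → ℝ≥0∞} (hv : Measurable v)
    (hpot : ∀ p ∈ D.K, ∫⁻ y, (β + v y) ∂D.Gker α p ≤ v p.1)
    {μ : Measure (D.E × (U × U))} (hμ : μ D.Kᶜ = 0) :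
    β * (D.Gker α ∘ₘ μ) univ + ∫⁻ y, v y ∂(D.Gker α ∘ₘ μ) ≤ ∫⁻ p, v p.1 ∂μ := by
  rw [← lintegral_const, ← lintegral_add_left measurable_const,
    Measure.lintegral_bind (Kernel.aemeasurable _) (by fun_prop)]
  refine lintegral_mono_ae ?_
  filter_upwards [mem_ae_iff.mpr hμ] with p hp using hpot p hp

/-- Telescoping in additive form, which avoids truncated subtraction in `[0, ∞]`. -/
lemma tsum_lt_top_of_mul_add_le {β : ℝ≥0∞} (hβ : 0 < β) {a W : ℕ → ℝ≥0∞} (hW : W 0 < ⊤)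
    (h : ∀ n, β * a n + W (n + 1) ≤ W n) : ∑' n, a n < ⊤ := by
  have h1 : ∀ n, β * ∑ k ∈ Finset.range n, a k + W n ≤ W 0 := by
    intro n
    induction n with
    | zero => simp
    | succ n ih =>
      rw [Finset.sum_range_succ, mul_add, add_assoc]
      exact (add_le_add le_rfl (h n)).trans ih
  have h2 : β * ∑' n, a n ≤ W 0 := by
    rw [← ENNReal.tsum_mul_left]
    refine ENNReal.tsum_le_of_sum_range_le fun n => ?_
    rw [← Finset.mul_sum]
    exact le_self_add.trans (h1 n)
  exact ENNReal.lt_top_of_mul_ne_top_right (h2.trans_lt hW).ne hβ.ne'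

section Feasible

variable {m : ℕ} {C : PDMPCosts D m} {α c₀ : ℝ≥0}

/-- On `𝒦` the infimum `w₀` is at most `w`, so `v ≤ M w` there. -/
lemma lintegral_potential_le {v : D.E → ℝ≥0∞} {M : ℝ≥0} (hvM : ∀ x, v x ≤ M * w₀ C α c₀ x)
    {μ : Measure (D.E × (U × U))} (hμ : μ D.Kᶜ = 0) :
    ∫⁻ p, v p.1 ∂μ ≤ M * ∫⁻ p, w C α c₀ p ∂μ := by
  rw [← lintegral_const_mul' _ _ ENNReal.coe_ne_top]
  refine lintegral_mono_ae ?_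
  filter_upwards [mem_ae_iff.mpr hμ] with p hp
  exact (hvM p.1).trans (mul_le_mul_right (iInf₂_le p.2 hp) _)

lemma lintegral_w (μ : Measure (D.E × (U × U))) :
    ∫⁻ p, w C α c₀ p ∂μ = c₀ * μ univ + ∫⁻ p, stage C α 0 p ∂μ := by
  simp only [w]
  rw [lintegral_add_left measurable_const, lintegral_const]

/-! ### Occupation measures and the balance equation -/

section Occ

variable (ν₀ : Measure D.E) [IsProbabilityMeasure ν₀] (u : D.Strategy)

lemma disc_compl_K (hK : MeasurableSet D.K) (k : ℕ) : disc ν₀ u α k D.Kᶜ = 0 := by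
  cases k with
  | zero => rw [disc_zero]; exact compProd_compl_K hK _ _
  | succ k => rw [disc_succ]; exact compProd_compl_K hK _ _

lemma disc_zero_fst : (disc ν₀ u α 0).fst = ν₀ := by
  rw [disc_zero, Measure.fst_compProd]

lemma disc_succ_fst (k : ℕ) : (disc ν₀ u α (k + 1)).fst = D.Gker α ∘ₘ disc ν₀ u α k := by
  rw [disc_succ, Measure.fst_compProd]

lemma occ_compl_K (hK : MeasurableSet D.K) : occ α ν₀ u D.Kᶜ = 0 := by
  rw [occ_eq_sum_disc, Measure.sum_apply _ hK.compl]
  simp [disc_compl_K ν₀ u hK]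

/-- `G` carries the `k`-th discounted law to the marginal of the next one, so the sum is shifted by
one index and only the initial marginal `ν₀` is left over. -/
lemma occ_fst (hrate : RateBounds D) {B : Set D.E} (hB : MeasurableSet B) :
    (occ α ν₀ u).fst B = ν₀ B + ∫⁻ p, G α p B ∂occ α ν₀ u := by
  have h : ∀ k, ∫⁻ p, G α p B ∂disc ν₀ u α k = (disc ν₀ u α (k + 1)).fst B := by
    intro k
    rw [disc_succ_fst, Measure.bind_apply hB (Kernel.aemeasurable _)]
    simp only [Gker_apply hrate α _ hB]
  rw [occ_eq_sum_disc, lintegral_sum_measure, Measure.fst_apply hB,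
    Measure.sum_apply _ (measurable_fst hB), tsum_eq_zero_add' ENNReal.summable]
  simp only [h, ← Measure.fst_apply hB, disc_zero_fst]

/-- The stage cost under the initial law is one term of the finite total cost, so the initial
integral of the potential is finite; the potential inequality then makes the later masses summable.
-/
lemma isFiniteMeasure_occ (hα : 0 < α) (hK : MeasurableSet D.K) (hrate : RateBounds D)
    (hgrowth : Growth C α c₀) (hcost : cost C α ν₀ 0 u < ⊤) : IsFiniteMeasure (occ α ν₀ u) := by
  obtain ⟨β, M, v, hβ, hv, hvM, hpot⟩ := hgrowth.exists_potential hα hrate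
  have h0 : ∫⁻ p, v p.1 ∂disc ν₀ u α 0 < ⊤ := by
    refine (lintegral_potential_le hvM (disc_compl_K ν₀ u hK 0)).trans_lt ?_
    rw [lintegral_w]
    refine ENNReal.mul_lt_top ENNReal.coe_lt_top (ENNReal.add_lt_top.mpr
      ⟨ENNReal.mul_lt_top ENNReal.coe_lt_top (measure_lt_top _ _), lt_of_le_of_lt ?_ hcost⟩)
    rw [cost_eq_lintegral_occ C hα hrate, occ_eq_sum_disc, lintegral_sum_measure]
    exact ENNReal.le_tsum 0
  have hsum := tsum_lt_top_of_mul_add_le hβ (a := fun k => (disc ν₀ u α (k + 1)) univ)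
    (W := fun k => ∫⁻ p, v p.1 ∂disc ν₀ u α k) h0 fun k => by
      have := mul_comp_Gker_add_lintegral_le hv hpot (disc_compl_K ν₀ u (α := α) hK k)
      rw [← disc_succ_fst, Measure.fst_univ, Measure.fst, lintegral_map hv measurable_fst] at this
      exact this
  refine ⟨?_⟩
  rw [occ_eq_sum_disc, Measure.sum_apply _ MeasurableSet.univ,
    tsum_eq_zero_add' ENNReal.summable]
  exact ENNReal.add_lt_top.mpr ⟨measure_lt_top _ _, hsum⟩

lemma feasibleMeasure_occ (hα : 0 < α) (hK : MeasurableSet D.K) (hrate : RateBounds D)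
    (hgrowth : Growth C α c₀) (hu : FeasibleStrategy C α ν₀ u) :
    FeasibleMeasure C α ν₀ c₀ (occ α ν₀ u) := by
  have hfin := isFiniteMeasure_occ ν₀ u hα hK hrate hgrowth hu.1
  have hKc := occ_compl_K (α := α) ν₀ u hK
  refine ⟨⟨hfin, hKc, ?_⟩, fun B hB => ?_, fun i => ?_⟩
  · rw [restrict_K hKc, lintegral_w, ← cost_eq_lintegral_occ C hα hrate]
    exact ENNReal.add_lt_top.mpr
      ⟨ENNReal.mul_lt_top ENNReal.coe_lt_top (measure_lt_top _ _), hu.1⟩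
  · rw [restrict_K hKc, occ_fst ν₀ u hrate hB]
  · rw [restrict_K hKc, ← cost_eq_lintegral_occ C hα hrate]
    exact hu.2 i

/-- A feasible measure disintegrated by the selector `φ` is the occupation measure of `U^φ`. -/
lemma occ_stationary_eq (hα : 0 < α) (hK : MeasurableSet D.K) (hrate : RateBounds D)
    (hgrowth : Growth C α c₀) {μ : Measure (D.E × (U × U))} (hμ : FeasibleMeasure C α ν₀ c₀ μ)
    {φ : D.Selector} (hφ : μ.fst ⊗ₘ φ.ker = μ) : occ α ν₀ (D.stationary φ) = μ := by
  obtain ⟨β, M, v, hβ, hv, hvM, hpot⟩ := hgrowth.exists_potential hα hrate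
  obtain ⟨⟨hfin, hKc, hw⟩, hmarg, -⟩ := hμ
  simp only [restrict_K hKc] at hw hmarg
  -- `ρ n` is the remainder after `n` iterations of the balance equation under `φ`.
  set ρ : ℕ → Measure (D.E × (U × U)) := fun n =>
    Nat.rec μ (fun _ κ => (D.Gker α ∘ₘ κ) ⊗ₘ φ.ker) n with hρ
  have hρ0 : ρ 0 = μ := rfl
  have hρs : ∀ n, ρ (n + 1) = (D.Gker α ∘ₘ ρ n) ⊗ₘ φ.ker := fun n => rfl
  have hρfin : ∀ n, IsFiniteMeasure (ρ n) := by
    intro n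
    induction n with
    | zero => exact hfin
    | succ n ih => rw [hρs]; infer_instance
  have hρK : ∀ n, ρ n D.Kᶜ = 0 := by
    intro n
    cases n with
    | zero => exact hKc
    | succ n => rw [hρs]; exact compProd_compl_K hK _ _
  have hfst : μ.fst = ν₀ + D.Gker α ∘ₘ μ := by
    ext B hB
    rw [hmarg B hB, Measure.add_apply, Measure.bind_apply hB (Kernel.aemeasurable _)]
    simp only [Gker_apply hrate α _ hB]
  -- For `n = 0` this is the balance equation disintegrated by `φ`; applying `G` and then `φ`
  -- carries it from `n` to `n + 1`.
  have hsplit : ∀ n, ρ n = disc ν₀ (D.stationary φ) α n + ρ (n + 1) := by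
    intro n
    induction n with
    | zero =>
      rw [disc_zero, hρs, hρ0]
      conv_lhs => rw [← hφ, hfst]
      rw [Measure.compProd_add_left]
      rfl
    | succ n ih =>
      rw [disc_succ, hρs (n + 1)]
      conv_lhs => rw [hρs, ih]
      rw [Measure.comp_add, Measure.compProd_add_left]
      rfl
  have hsum := tsum_lt_top_of_mul_add_le hβ (a := fun k => ρ (k + 1) univ)
    (W := fun k => ∫⁻ p, v p.1 ∂ρ k)
    ((lintegral_potential_le hvM hKc).trans_lt (ENNReal.mul_lt_top ENNReal.coe_lt_top hw))
    fun k => by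
      have := mul_comp_Gker_add_lintegral_le hv hpot (hρK k)
      have h1 : (ρ (k + 1)).fst = D.Gker α ∘ₘ ρ k := by rw [hρs, Measure.fst_compProd]
      rw [← h1, Measure.fst_univ, Measure.fst, lintegral_map hv measurable_fst] at this
      exact this
  have hlim : Tendsto (fun k => ρ (k + 1) univ) atTop (𝓝 0) :=
    ENNReal.tendsto_atTop_zero_of_tsum_ne_top hsum.ne
  have hpart : ∀ (A : Set (D.E × (U × U))) (n : ℕ),
      μ A = ∑ k ∈ Finset.range n, disc ν₀ (D.stationary φ) α k A + ρ n A := by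
    intro A n
    induction n with
    | zero => simp [hρ0]
    | succ n ih => rw [ih, Finset.sum_range_succ, add_assoc, ← Measure.add_apply, ← hsplit n]
  ext A hA
  rw [occ_eq_sum_disc, Measure.sum_apply _ hA]
  have h1 : Tendsto (fun k => ρ (k + 1) A) atTop (𝓝 0) :=
    tendsto_of_tendsto_of_tendsto_of_le_of_le tendsto_const_nhds hlim
      (fun _ => bot_le) (fun _ => measure_mono (subset_univ _))
  have h2 := ((ENNReal.tendsto_nat_tsum fun k => disc ν₀ (D.stationary φ) α k A).comp
    (tendsto_add_atTop_nat 1)).add h1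
  rw [add_zero] at h2
  refine tendsto_nhds_unique h2 (tendsto_const_nhds.congr fun n => ?_)
  exact hpart A (n + 1)

end Occ

end Feasible

end PDMP

/-! ### Equality of the control problem and the linear program -/

theorem theorem5p9 {d m : ℕ} {U V : Type*}
    [MeasurableSpace U] [StandardBorelSpace U] [MeasurableSpace V] [StandardBorelSpace V]
    (D : PDMP d U V) (C : PDMPCosts D m) (α : ℝ≥0) (hα : 0 < α)
    (ν₀ : Measure D.E) [IsProbabilityMeasure ν₀] (c₀ : ℝ≥0) (hc₀ : 0 < c₀)
    (hK : MeasurableSet D.K)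
    (hvalue : PDMP.value C α ν₀ < ⊤)
    (hrate : PDMP.RateBounds D)
    (hgrowth : PDMP.Growth C α c₀) :
    (∀ u : D.Strategy, PDMP.FeasibleStrategy C α ν₀ u →
      PDMP.FeasibleMeasure C α ν₀ c₀ (PDMP.occ α ν₀ u) ∧
      PDMP.cost C α ν₀ 0 u = ∫⁻ p in D.K, PDMP.stage C α 0 p ∂(PDMP.occ α ν₀ u) ∧
      PDMP.lpValue C α ν₀ c₀ ≤ ∫⁻ p in D.K, PDMP.stage C α 0 p ∂(PDMP.occ α ν₀ u)) ∧
    (∀ μ : Measure (D.E × (U × U)), PDMP.FeasibleMeasure C α ν₀ c₀ μ →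
      ∃ φ : D.Selector,
        PDMP.value C α ν₀ ≤ PDMP.cost C α ν₀ 0 (D.stationary φ) ∧
        PDMP.cost C α ν₀ 0 (D.stationary φ) = ∫⁻ p in D.K, PDMP.stage C α 0 p ∂μ ∧
        ∫⁻ p in D.K, PDMP.stage C α 0 p ∂μ =
          ∫⁻ x, PDMP.avg (PDMP.stage C α 0) φ x ∂μ.fst ∧
        PDMP.Satisfies C α ν₀ (D.stationary φ)) ∧
    PDMP.value C α ν₀ = PDMP.lpValue C α ν₀ c₀ := by
  have ha : ∀ u : D.Strategy, PDMP.FeasibleStrategy C α ν₀ u →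
      PDMP.FeasibleMeasure C α ν₀ c₀ (PDMP.occ α ν₀ u) ∧
      PDMP.cost C α ν₀ 0 u = ∫⁻ p in D.K, PDMP.stage C α 0 p ∂(PDMP.occ α ν₀ u) ∧
      PDMP.lpValue C α ν₀ c₀ ≤ ∫⁻ p in D.K, PDMP.stage C α 0 p ∂(PDMP.occ α ν₀ u) := by
    intro u hu
    have hf := PDMP.feasibleMeasure_occ ν₀ u hα hK hrate hgrowth hu
    refine ⟨hf, ?_, iInf₂_le _ hf⟩
    rw [PDMP.restrict_K (PDMP.occ_compl_K ν₀ u hK), PDMP.cost_eq_lintegral_occ C hα hrate]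
  have hb : ∀ μ : Measure (D.E × (U × U)), PDMP.FeasibleMeasure C α ν₀ c₀ μ →
      ∃ φ : D.Selector,
        PDMP.value C α ν₀ ≤ PDMP.cost C α ν₀ 0 (D.stationary φ) ∧
        PDMP.cost C α ν₀ 0 (D.stationary φ) = ∫⁻ p in D.K, PDMP.stage C α 0 p ∂μ ∧
        ∫⁻ p in D.K, PDMP.stage C α 0 p ∂μ =
          ∫⁻ x, PDMP.avg (PDMP.stage C α 0) φ x ∂μ.fst ∧
        PDMP.Satisfies C α ν₀ (D.stationary φ) := by
    intro μ hμ
    -- A finite value means that some strategy exists; its first selector is the fallback on the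
    -- null set where the conditional kernel of `μ` fails to be feasible.
    obtain ⟨u₀, -⟩ := iInf_lt_iff.mp hvalue
    have : Nonempty D.E := ν₀.nonempty_of_neZero
    have hfin : IsFiniteMeasure μ := hμ.1.1
    have hKc := hμ.1.2.1
    obtain ⟨φ, hφ⟩ := PDMP.exists_selector_compProd hK (u₀ 0) μ hKc
    have hocc := PDMP.occ_stationary_eq ν₀ hα hK hrate hgrowth hμ hφ
    have hcost : ∀ i, PDMP.cost C α ν₀ i (D.stationary φ) =
        ∫⁻ p in D.K, PDMP.stage C α i p ∂μ := fun i => by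
      rw [PDMP.restrict_K hKc, PDMP.cost_eq_lintegral_occ C hα hrate, hocc]
    have hsat : PDMP.Satisfies C α ν₀ (D.stationary φ) := fun i => by
      rw [hcost]
      exact hμ.2.2 i
    refine ⟨φ, iInf₂_le _ hsat, hcost 0, ?_, hsat⟩
    rw [PDMP.restrict_K hKc,
      ← PDMP.lintegral_compProd_eq_avg hK μ.fst φ (PDMP.measurable_stage C α 0), hφ]
  refine ⟨ha, hb, le_antisymm (le_iInf₂ fun μ hμ => ?_) (le_iInf₂ fun u hu => ?_)⟩
  · obtain ⟨φ, h1, h2, -⟩ := hb μ hμ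
    exact h1.trans h2.le
  · rcases eq_or_ne (PDMP.cost C α ν₀ 0 u) ⊤ with h | h
    · rw [h]
      exact le_top
    · obtain ⟨-, h1, h2⟩ := ha u ⟨lt_top_iff_ne_top.mpr h, hu⟩
      exact h2.trans h1.ge
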